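/- **Setting.** Write $\log=\log_2$. Let $\mathcal C$ be a fixed probability distribution on $\mathbb R$ that has a density bounded by a constant $c>0$ and a finite first absolute moment. For each $p\in\mathbb N$ let $n=n_p,\ Q=Q_p\in\mathbb Z_{>0}$ and $R=R_p,\ \sigma=\sigma_p>0$ be real. Let $T_p$ be the set of $\beta\in[-R,R]^p$ all of whose entries are of the form $K/Q$ with $K\in\mathbb Z$ ($Q$-rationality). For $\beta^*\in T_p$ one observes $(Y,X)$, where $Y=X\beta^*+W\in\mathbb R^n$, $X\in\mathbb R^{n\times p}$ has iid entries of law $\mathcal C$, and $W$ is independent of $X$ with iid $N(0,\sigma^2)$ entries. **ELO algorithm.** Input: $Y\in\mathbb Z^n$, $X\in\mathbb Z^{n\times p}$, $\hat R,\hat W\in\mathbb Z_{>0}$. (1) Draw $Z\in\mathbb Z^p$ with iid entries uniform on the integers of $[\hat R+1,\,2\hat R+\log p]$. (2) Put $Y_1=Y+XZ$; let $(Y_2)_i=3$ if $|(Y_1)_i|<3$ and $(Y_2)_i=(Y_1)_i$ otherwise. (3) Put $m=2^{n+\lceil p/2\rceil+3}\,p\,(\hat R\lceil\sqrt p\rceil+\hat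 W\lceil\sqrt n\rceil)$. (4) Let $\hat z\in\mathbb Z^{2n+p}$ be the first vector of the basis returned by the LLL algorithm (Lovász parameter $3/4$) started from the columns of $$\begin{pmatrix} mX & -m\,\mathrm{Diag}(Y_2) & mI_n\\ I_p&0&0\\ 0&0&I_n\end{pmatrix}.$$ (5) Let $v=(\hat z_{n+1},\dots,\hat z_{n+p})$, and let $g$ be the greatest common divisor of the entries of $v$, taken with a negative sign if the sum of these entries is negative. Output $v/g-Z$ if $g\ne0$, and $0$ otherwise. **LBR algorithm.** Input: $Y\in\mathbb R^n$, $X\in\mathbb R^{n\times p}$, $N,\hat Q,\hat R,\hat W$. With $x_N=\mathrm{sign}(x)\lfloor 2^N|x|\rfloor/2^N$ applied entrywise, run ELO on $\bigl(2^N\hat Q\,Y_N,\ 2^NX_N,\ \hat Q\hat R,\ 2\hat Q(2^N\hat W+\hat Rp)\bigr)$ and divide its output by $\hat Q$. **Proposition.** Suppose that $n=o(p/\log p)$ and $RQ=2^{\omega(p)}$ (that is, $\log(RQ)/p\to\infty$) as $p\to\infty$. Put $\sigma_0=2^{-p\log(RQ)/n}$ and let $\epsilon>0$. * If $\sigma>\sigma_0^{1-\epsilon}$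 for all large $p$, then exact recovery with high probability is information-theoretically impossible: for every sequence of (measurable, possibly randomised) estimators $\hat\beta=\hat\beta_p(Y,X)$, which may depend on $n,p,Q,R,\sigma$ and $\mathcal C$, there are $\beta^*_p\in T_p$ with $$\limsup_{p\to\infty}\mathbb P(\hat\beta=\beta^*_p)<1.$$ * If $\sigma<\sigma_0^{1+\epsilon}$ and $R\ge1$ for all large $p$, then the LBR algorithm recovers $\beta^*$ exactly with high probability: when it is run with $\hat Q=Q$, $\hat R=\lceil R\rceil$, $\hat W=1$ and truncation level $N=\lfloor\log(1/\sigma)\rfloor$, for every choice of $\beta^*_p\in T_p$ the probability that it outputs exactly $\beta^*_p$ tends to $1$ as $p\to\infty$. -/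

import Mathlib

open MeasureTheory ProbabilityTheory Filter Topology Asymptotics
open scoped ENNReal

/-! ### The LLL lattice basis reduction algorithm -/

namespace LLL

noncomputable section

variable {m : ℕ} {ι : Type*} [Fintype ι]

/-- An integer vector, seen in Euclidean space. -/
def toEuclidean (v : ι → ℤ) : EuclideanSpace ℝ ι := WithLp.toLp 2 fun i => (v i : ℝ)

/-- The Gram–Schmidt orthogonalisation `b*` of the ordered integer basis `b`. -/
def gs (b : Fin m → ι → ℤ) : Fin m → EuclideanSpace ℝ ι :=
  InnerProductSpace.gramSchmidt ℝ fun i => toEuclidean (b i)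

/-- The Gram–Schmidt coefficient `μ_{ij} = ⟨b_i, b*_j⟩ / ‖b*_j‖²`. -/
def mu (b : Fin m → ι → ℤ) (i j : Fin m) : ℝ :=
  inner ℝ (toEuclidean (b i)) (gs b j) / ‖gs b j‖ ^ 2

/-- Replace `b_i` by `b_i - ⌈μ_{ij}⌋ b_j`. -/
def reduceAt (i : Fin m) (b : Fin m → ι → ℤ) (j : Fin m) : Fin m → ι → ℤ :=
  Function.update b i (b i - round (mu b i j) • b j)

/-- Reduce `b_i` by `b_{i-1}, …, b_0`, in this order. -/
def reduceRow (b : Fin m → ι → ℤ) (i : Fin m) : Fin m → ι → ℤ :=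
  (((List.finRange m).filter (· < i)).reverse).foldl (reduceAt i) b

/-- Size reduction: reduce all vectors of the basis, in increasing order of the index. -/
def sizeReduce (b : Fin m → ι → ℤ) : Fin m → ι → ℤ :=
  (List.finRange m).foldl reduceRow b

/-- The predecessor of a nonzero index. -/
def prev (i : Fin m) : Fin m := ⟨i.val - 1, by omega⟩

/-- The Lovász condition, with the classical parameter `3/4`, fails between `b_{i-1}` and `b_i`. -/
def LovaszFails (b : Fin m → ι → ℤ) (i : Fin m) : Prop :=
  0 < i.val ∧ ‖gs b i‖ ^ 2 < (3 / 4 - mu b i (prev i) ^ 2) * ‖gs b (prev i)‖ ^ 2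

open Classical in
/-- The smallest index at which the Lovász condition fails, if there is one. -/
def firstFailure (b : Fin m → ι → ℤ) : Option (Fin m) :=
  (List.finRange m).find? fun i => decide (LovaszFails b i)

/-- One round of the algorithm: size-reduce the basis, then swap the two vectors at the first
failure of the Lovász condition (if there is one). -/
def step (b : Fin m → ι → ℤ) : Fin m → ι → ℤ :=
  match firstFailure (sizeReduce b) with
  | none => sizeReduce b
  | some i => fun j => sizeReduce b (Equiv.swap (prev i) i j)

/-- The stopping criterion: the size-reduced basis satisfies all Lovász conditions. -/
def Stops (b : Fin m → ι → ℤ) : Prop := firstFailure (sizeReduce b) = none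

open Classical in
/-- The basis returned by the LLL algorithm started from `b`: rounds are performed until the
stopping criterion is met for the first time. (For a linearly independent `b` this always happens;
the value in the other case is irrelevant.) -/
def reducedBasis (b : Fin m → ι → ℤ) : Fin m → ι → ℤ :=
  if h : ∃ t : ℕ, Stops (step^[t] b) then sizeReduce (step^[Nat.find h] b) else b

/-- The short lattice vector returned by the LLL algorithm: the first vector of the reduced
basis. -/
def output (b : Fin m → ι → ℤ) : ι → ℤ :=
  if h : 0 < m then reducedBasis b ⟨0, h⟩ else 0

end

end LLL

/-! ### The Extended Lagarias–Odlyzko (ELO) algorithm -/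

namespace ELO

noncomputable section

variable {n p : ℕ}

/-- The law of the random translation `Z`: iid entries, uniform on the integers of the interval
`[R̂ + 1, 2 R̂ + log₂ p]`. -/
def translationLaw (p Rhat : ℕ) : Measure (Fin p → ℤ) :=
  Measure.pi fun _ => uniformOn (Set.Icc ((Rhat : ℤ) + 1) (2 * (Rhat : ℤ) + (Nat.log 2 p : ℤ)))

/-- The modified translated observations `Y₂`, built from `Y₁ = Y + X Z`. -/
def modified (Y : Fin n → ℤ) (X : Fin n → Fin p → ℤ) (Z : Fin p → ℤ) (i : Fin n) : ℤ :=
  if |Y i + ∑ j, X i j * Z j| < 3 then 3 else Y i + ∑ j, X i j * Z j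

/-- The multiplier `m = 2 ^ (n + ⌈p/2⌉ + 3) · p · (R̂ ⌈√p⌉ + Ŵ ⌈√n⌉)`. -/
def multiplier (n p Rhat What : ℕ) : ℕ :=
  2 ^ (n + (p + 1) / 2 + 3) * p * (Rhat * ⌈Real.sqrt p⌉₊ + What * ⌈Real.sqrt n⌉₊)

/-- The columns of the `(2n+p) × (2n+p)` matrix
`[ m X, -m Diag(Y₂), m I ; I, 0, 0 ; 0, 0, I ]`.
Columns are ordered as `p`, `n`, `n`; the rows are indexed by the blocks `n`, `p`, `n`. -/
def columns (m : ℤ) (X : Fin n → Fin p → ℤ) (Y₂ : Fin n → ℤ) :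
    Fin (p + n + n) → (Fin n ⊕ Fin p ⊕ Fin n) → ℤ :=
  Fin.append
    (Fin.append
      (fun j : Fin p =>
        Sum.elim (fun i => m * X i j) (Sum.elim (fun k => if k = j then 1 else 0) fun _ => 0))
      (fun j : Fin n =>
        Sum.elim (fun i => if i = j then -m * Y₂ j else 0) (Sum.elim (fun _ => 0) fun _ => 0)))
    (fun j : Fin n =>
      Sum.elim (fun i => if i = j then m else 0)
        (Sum.elim (fun _ => 0) fun k => if k = j then 1 else 0))

/-- The greatest common divisor of the entries of an integer vector, with a sign: it is negative
if the sum of the entries is. In this way `gcd (l • v) = l` for every integer `l` when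
`v` has positive entries with greatest common divisor `1`. -/
def signedGcd (v : Fin p → ℤ) : ℤ :=
  if ∑ j, v j < 0 then -(Finset.univ.gcd v) else Finset.univ.gcd v

/-- The output of the ELO algorithm on the input `(Y, X, R̂, Ŵ)` when the random translation
drawn by the algorithm is `Z`. -/
def run (Y : Fin n → ℤ) (X : Fin n → Fin p → ℤ) (Rhat What : ℕ) (Z : Fin p → ℤ) : Fin p → ℝ :=
  let zhat := LLL.output (columns (multiplier n p Rhat What : ℤ) X (modified Y X Z))
  let v : Fin p → ℤ := fun j => zhat (Sum.inr (Sum.inl j))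
  let g := signedGcd v
  if g ≠ 0 then fun j => (v j : ℝ) / (g : ℝ) - (Z j : ℝ) else 0

end

end ELO

/-! ### The Lattice-Based Regression (LBR) algorithm -/

namespace LBR

noncomputable section

variable {n p : ℕ}

/-- The integer `2 ^ N · x_N`, where `x_N = sign x · ⌊2 ^ N |x|⌋ / 2 ^ N` keeps the first `N` bits
of `x` after zero. -/
def trunc (N : ℕ) (x : ℝ) : ℤ := (SignType.sign x : ℤ) * ⌊2 ^ N * |x|⌋

/-- The output of the LBR algorithm on the input `(Y, X, N, Q̂, R̂, Ŵ)` when the random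
translation drawn by its ELO subroutine is `Z`: ELO is run on
`(2 ^ N Q̂ Y_N, 2 ^ N X_N, Q̂ R̂, 2 Q̂ (2 ^ N Ŵ + R̂ p))` and its output is divided by `Q̂`. -/
def run (Y : Fin n → ℝ) (X : Fin n → Fin p → ℝ) (N Qhat Rhat What : ℕ) (Z : Fin p → ℤ) :
    Fin p → ℝ :=
  fun j => ELO.run (fun i => (Qhat : ℤ) * trunc N (Y i)) (fun i j => trunc N (X i j))
    (Qhat * Rhat) (2 * Qhat * (2 ^ N * What + Rhat * p)) Z j / (Qhat : ℝ)

/-- The law of the output of the (randomised) LBR algorithm, given the data `d = (Y, X)`. -/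
def law (N Qhat Rhat What : ℕ) (d : (Fin n → ℝ) × (Fin n → Fin p → ℝ)) : Measure (Fin p → ℝ) :=
  (ELO.translationLaw p (Qhat * Rhat)).map fun Z => run d.1 d.2 N Qhat Rhat What Z

end

end LBR

/-! ### The regression model -/

noncomputable section

/-- `D` has a density with respect to Lebesgue measure whose `L^∞` norm is at most `c`. -/
def HasDensityBoundedBy (D : Measure ℝ) (c : ℝ) : Prop :=
  ∃ f : ℝ → ℝ≥0∞, Measurable f ∧ D = volume.withDensity f ∧ ∀ᵐ x, f x ≤ ENNReal.ofReal c

/-- The vectors in `[-R, R]^p` that satisfy the `Q`-rationality assumption. -/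
def admissible (p Q : ℕ) (R : ℝ) : Set (Fin p → ℝ) :=
  {β | ∀ i, β i ∈ Set.Icc (-R) R ∧ ∃ K : ℤ, β i = (K : ℝ) / (Q : ℝ)}

/-- The law of the data `(Y, X)`, where `Y = X β + W`, the matrix `X` has iid entries of law `D`,
and `W`, independent of `X`, has iid `N(0, σ²)` entries. -/
def dataLaw {p : ℕ} (n : ℕ) (D : Measure ℝ) (σ : ℝ) (β : Fin p → ℝ) :
    Measure ((Fin n → ℝ) × (Fin n → Fin p → ℝ)) :=
  ((Measure.pi fun _ : Fin n => Measure.pi fun _ : Fin p => D).prod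
    (Measure.pi fun _ : Fin n => gaussianReal 0 (Real.toNNReal (σ ^ 2)))).map
    fun XW => (fun i => (∑ j, XW.1 i j * β j) + XW.2 i, XW.1)

/-- The probability that a (possibly randomised) recovery mechanism outputs exactly `β`, when the
data are generated with ground truth `β`. Here `κ d` is the law of its output given the data `d`. -/
def recoveryProb {n p : ℕ} (D : Measure ℝ) (σ : ℝ) (β : Fin p → ℝ)
    (κ : (Fin n → ℝ) × (Fin n → Fin p → ℝ) → Measure (Fin p → ℝ)) : ℝ≥0∞ :=
  ∫⁻ d, κ d {β} ∂(dataLaw n D σ β)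

/-- The threshold `σ₀ = 2 ^ (-p log₂(R Q) / n)`. -/
def sigmaZero (n p Q : ℕ) (R : ℝ) : ℝ :=
  (2 : ℝ) ^ (-((p : ℝ) * Real.logb 2 (R * Q) / (n : ℝ)))

end

/-! ### Correctness of the LLL algorithm -/

namespace LLL

variable {m : ℕ} {ι : Type*}

/-! Both halves compare two counts: the roughly `(R Q) ^ p` coefficient vectors, and the number of
cells of size `σ` that the observations in `ℝⁿ` can distinguish. The two balance when `σ ^ (-n)` is
about `(R Q) ^ p`, that is, at `σ₀`.

Impossibility. Given `X`, the law of `Y` has density at most `σ ^ (-n)`, and for fixed `(Y, X)` an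
estimator spreads total mass at most `1` over all candidates `β`. Hence the probabilities of
recovering `β` with `Y` in a box `E`, summed over all `β` in a finite grid, are at most `σ ^ (-n)
vol E` (`sum_setLIntegral_le`). Markov and Chebyshev give a box of side `O(n R p + n σ)` that
contains `Y` with probability at least `1 / 2`. Averaging over the at least `(R Q) ^ p` grid points
produces a `β` recovered with probability at most `1 / 2` plus a ratio (`exists_recoveryProb_le`),
which above the threshold is at most `1 / 4` (`impossibility_bound`). The condition `n log p = o(p)`
absorbs the polynomial factors raised to the power `n`.

Recovery. Write `β = b / Q`, `G = Q ⌈R⌉` and `u₀ = b + Z`. The lattice of ELO contains a short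
vector carrying `u₀`, so LLL returns a nonzero vector with entries at most `A = 2 ^ O(p) G`
(`LLL.output_spec`). The multiplier exceeds `A`, which forces the first block to vanish: the output
is an exact integer relation `X v - Y₂ y + w = 0` with small `v` and `w`. Since `Y₂` is close to `2
^ N X u₀`, each row gives a vector `v - yᵢ u₀` almost orthogonal to the row of real data, with `yᵢ`
polynomially larger than `A` at most. If `v` is not a multiple of `u₀`, all these integer vectors
are nonzero, and the bounded density makes each row exceptional with probability at most `2 ^ O(p) G
^ 3 / 2 ^ N`. The rows are independent, so a union bound over `(2 A + 1) ^ p` vectors `v`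
(`pi_exists_relation_le`) succeeds because `2 ^ (N n)` is about `σ ^ (-n) > (R Q) ^ (p (1 + ε))`,
while `n = o(p)` and `p = o(log (R Q))` make all other factors negligible. So `v = l u₀` with `l ≠
0`. The random translation makes the entries of `u₀` positive and, with high probability, coprime
(`ELO.translationLaw_gcd_ne_one_le`), so dividing by the signed gcd returns `u₀`, hence `b`. -/

theorem toEuclidean_add (v w : ι → ℤ) : toEuclidean (v + w) = toEuclidean v + toEuclidean w := by
  ext i; simp [toEuclidean]

theorem toEuclidean_smul (a : ℤ) (v : ι → ℤ) :
    toEuclidean (a • v) = (a : ℝ) • toEuclidean v := by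
  ext i; simp [toEuclidean]

theorem toEuclidean_sub (v w : ι → ℤ) : toEuclidean (v - w) = toEuclidean v - toEuclidean w := by
  ext i; simp [toEuclidean]

theorem toEuclidean_sum {κ : Type*} (s : Finset κ) (v : κ → ι → ℤ) :
    toEuclidean (∑ k ∈ s, v k) = ∑ k ∈ s, toEuclidean (v k) := by
  ext i; simp [toEuclidean]

theorem span_toEuclidean (b : Fin m → ι → ℤ) :
    Submodule.span ℝ (Set.range fun i => toEuclidean (b i)) =
      Submodule.span ℝ (toEuclidean '' (Submodule.span ℤ (Set.range b) : Set (ι → ℤ))) := by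
  apply le_antisymm
  · refine Submodule.span_mono ?_
    rintro _ ⟨i, rfl⟩
    exact ⟨b i, Submodule.subset_span ⟨i, rfl⟩, rfl⟩
  · rw [Submodule.span_le]
    rintro _ ⟨x, hx, rfl⟩
    induction hx using Submodule.span_induction with
    | mem x hx =>
      obtain ⟨i, rfl⟩ := hx
      exact Submodule.subset_span ⟨i, rfl⟩
    | zero =>
      have : toEuclidean (0 : ι → ℤ) = 0 := by ext i; simp [toEuclidean]
      rw [this]
      exact Submodule.zero_mem _
    | add x y _ _ hx hy => rw [toEuclidean_add]; exact Submodule.add_mem _ hx hy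
    | smul a x _ hx => rw [toEuclidean_smul]; exact Submodule.smul_mem _ _ hx

/-- Independence of `m` vectors means that their real span has dimension `m`, and this span depends
only on the lattice. Thus LLL rounds preserve independence. -/
theorem linearIndependent_of_span_eq {b b' : Fin m → ι → ℤ}
    (h : Submodule.span ℤ (Set.range b') = Submodule.span ℤ (Set.range b))
    (hb : LinearIndependent ℝ fun i => toEuclidean (b i)) :
    LinearIndependent ℝ fun i => toEuclidean (b' i) := by
  rw [linearIndependent_iff_card_eq_finrank_span] at hb ⊢
  rw [hb, Set.finrank, Set.finrank, span_toEuclidean b', h, ← span_toEuclidean b]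

variable [Fintype ι]

theorem norm_toEuclidean_sq (v : ι → ℤ) : ‖toEuclidean v‖ ^ 2 = ∑ i, (v i : ℝ) ^ 2 := by
  simp [EuclideanSpace.norm_sq_eq, toEuclidean]

theorem inner_toEuclidean (v w : ι → ℤ) :
    inner ℝ (toEuclidean v) (toEuclidean w) = ((∑ i, v i * w i : ℤ) : ℝ) := by
  simp [PiLp.inner_apply, toEuclidean, mul_comm]

/-! ### Characterisation and invariance of the Gram–Schmidt vectors. -/

theorem gs_orthogonal (b : Fin m → ι → ℤ) {i j : Fin m} (h : i ≠ j) :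
    inner ℝ (gs b i) (gs b j) = 0 :=
  InnerProductSpace.gramSchmidt_orthogonal ℝ _ h

theorem gs_sub_mem (b : Fin m → ι → ℤ) (i : Fin m) :
    gs b i - toEuclidean (b i) ∈ Submodule.span ℝ (gs b '' Set.Iio i) := by
  have h := InnerProductSpace.gramSchmidt_def'' ℝ (fun i => toEuclidean (b i)) i
  have h2 : gs b i - toEuclidean (b i) = - ∑ j ∈ Finset.Iio i,
      (inner ℝ (gs b j) (toEuclidean (b i)) / (‖gs b j‖ : ℝ) ^ 2) • gs b j := by
    rw [sub_eq_iff_eq_add, neg_add_eq_sub, eq_sub_iff_add_eq]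
    exact h.symm
  rw [h2]
  refine Submodule.neg_mem _ (Submodule.sum_mem _ fun j hj => Submodule.smul_mem _ _ ?_)
  exact Submodule.subset_span ⟨j, Finset.mem_Iio.1 hj, rfl⟩

theorem inner_eq_zero_of_mem_span {E : Type*} [NormedAddCommGroup E] [InnerProductSpace ℝ E]
    {S : Set E} {x y : E} (hy : y ∈ Submodule.span ℝ S) (h : ∀ z ∈ S, inner ℝ z x = 0) :
    inner ℝ y x = 0 := by
  induction hy using Submodule.span_induction with
  | mem z hz => exact h z hz
  | zero => simp
  | add a b _ _ ha hb => rw [inner_add_left, ha, hb, add_zero]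
  | smul a z _ hz => rw [inner_smul_left, hz, mul_zero]

/-- The difference of two such vectors lies in the span of the earlier `gs b j` and is orthogonal to
it. This uniqueness identifies Gram–Schmidt vectors after every basis change below. -/
theorem eq_gs_of_sub_mem (b : Fin m → ι → ℤ) (i : Fin m) (x : EuclideanSpace ℝ ι)
    (h1 : x - toEuclidean (b i) ∈ Submodule.span ℝ (gs b '' Set.Iio i))
    (h2 : ∀ j < i, inner ℝ (gs b j) x = 0) : x = gs b i := by
  have h3 : x - gs b i ∈ Submodule.span ℝ (gs b '' Set.Iio i) := by
    have := Submodule.sub_mem _ h1 (gs_sub_mem b i)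
    simpa using this
  have h4 : inner ℝ (x - gs b i) (x - gs b i) = 0 := by
    refine inner_eq_zero_of_mem_span h3 ?_
    rintro _ ⟨j, hj, rfl⟩
    rw [inner_sub_right, h2 j hj, gs_orthogonal b (ne_of_lt hj), sub_zero]
  exact sub_eq_zero.1 (inner_self_eq_zero.1 h4)

theorem gs_congr (b b' : Fin m → ι → ℤ)
    (h : ∀ i, toEuclidean (b' i) - toEuclidean (b i) ∈ Submodule.span ℝ (gs b '' Set.Iio i)) :
    gs b' = gs b := by
  ext1 k
  induction k using WellFoundedLT.induction with
  | ind k ih =>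
    have himg : gs b' '' Set.Iio k = gs b '' Set.Iio k := Set.image_congr fun j hj => ih j hj
    refine eq_gs_of_sub_mem b k _ ?_ fun j hj => ?_
    · have h1 := gs_sub_mem b' k
      rw [himg] at h1
      have := Submodule.add_mem _ h1 (h k)
      simpa using this
    · rw [← ih j hj]
      exact gs_orthogonal b' (ne_of_lt hj)

theorem toEuclidean_mem_span_gs (b : Fin m → ι → ℤ) {i k : Fin m} (h : i < k) :
    toEuclidean (b i) ∈ Submodule.span ℝ (gs b '' Set.Iio k) := by
  have h1 := Submodule.span_mono (R := ℝ) (Set.image_mono (f := gs b)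
    (Set.Iio_subset_Iio h.le)) (gs_sub_mem b i)
  have h2 : gs b i ∈ Submodule.span ℝ (gs b '' Set.Iio k) := Submodule.subset_span ⟨i, h, rfl⟩
  have := Submodule.sub_mem _ h2 h1
  simpa using this

theorem inner_gs_toEuclidean_of_lt (b : Fin m → ι → ℤ) {i j : Fin m} (h : i < j) :
    inner ℝ (gs b j) (toEuclidean (b i)) = 0 :=
  InnerProductSpace.gramSchmidt_inv_triangular ℝ _ h

theorem inner_toEuclidean_gs_self (b : Fin m → ι → ℤ) (i : Fin m) :
    inner ℝ (toEuclidean (b i)) (gs b i) = ‖gs b i‖ ^ 2 := by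
  have h : inner ℝ (gs b i - toEuclidean (b i)) (gs b i) = 0 := by
    refine inner_eq_zero_of_mem_span (gs_sub_mem b i) ?_
    rintro _ ⟨j, hj, rfl⟩
    exact gs_orthogonal b (ne_of_lt hj)
  rw [inner_sub_left, real_inner_self_eq_norm_sq] at h
  linarith

theorem mu_of_lt (b : Fin m → ι → ℤ) {i j : Fin m} (h : i < j) : mu b i j = 0 := by
  rw [mu, real_inner_comm, inner_gs_toEuclidean_of_lt b h, zero_div]

theorem mu_self (b : Fin m → ι → ℤ) {i : Fin m} (h : gs b i ≠ 0) : mu b i i = 1 := by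
  rw [mu, inner_toEuclidean_gs_self, div_self]
  simpa using h

/-! #### Size reduction -/

theorem gs_reduceAt (b : Fin m → ι → ℤ) {i j : Fin m} (h : j < i) :
    gs (reduceAt i b j) = gs b := by
  refine gs_congr _ _ fun l => ?_
  unfold reduceAt
  rcases eq_or_ne l i with rfl | hl
  · rw [Function.update_self, toEuclidean_sub, toEuclidean_smul, sub_sub_cancel_left]
    exact Submodule.neg_mem _ (Submodule.smul_mem _ _ (toEuclidean_mem_span_gs b h))
  · rw [Function.update_of_ne hl, sub_self]
    exact Submodule.zero_mem _

theorem mu_reduceAt_self (b : Fin m → ι → ℤ) {i j : Fin m} (h : j < i) (l : Fin m) :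
    mu (reduceAt i b j) i l = mu b i l - round (mu b i j) * mu b j l := by
  rw [mu, gs_reduceAt b h, reduceAt, Function.update_self, toEuclidean_sub, toEuclidean_smul,
    inner_sub_left, inner_smul_left, mu, mu, mu]
  simp
  ring

theorem span_reduceAt (b : Fin m → ι → ℤ) {i j : Fin m} (h : j ≠ i) :
    Submodule.span ℤ (Set.range (reduceAt i b j)) = Submodule.span ℤ (Set.range b) := by
  apply le_antisymm
  · rw [Submodule.span_le]
    rintro _ ⟨k, rfl⟩
    unfold reduceAt
    rcases eq_or_ne k i with rfl | hk
    · rw [Function.update_self]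
      exact Submodule.sub_mem _ (Submodule.subset_span ⟨k, rfl⟩)
        (Submodule.smul_mem _ _ (Submodule.subset_span ⟨j, rfl⟩))
    · rw [Function.update_of_ne hk]
      exact Submodule.subset_span ⟨k, rfl⟩
  · rw [Submodule.span_le]
    rintro _ ⟨k, rfl⟩
    have hm : ∀ l x, reduceAt i b j l = x →
        x ∈ Submodule.span ℤ (Set.range (reduceAt i b j)) :=
      fun l x hx => Submodule.subset_span ⟨l, hx⟩
    rcases eq_or_ne k i with rfl | hk
    · have h1 := hm k _ (Function.update_self ..)
      have h2 := hm j _ (Function.update_of_ne h ..)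
      have := Submodule.add_mem _ h1 (Submodule.smul_mem _ (round (mu b k j)) h2)
      simpa using this
    · exact hm k _ (Function.update_of_ne hk ..)

/-- The decreasing order matters: subtracting a multiple of `b_j` changes `μ_{ik}` only for `k ≤ j`,
so a coefficient once made at most `1 / 2` is left alone by the later reductions. -/
theorem foldl_reduceAt (i : Fin m) (l : List (Fin m)) (hl : l.Pairwise (· > ·))
    (hi : ∀ j ∈ l, j < i) (b : Fin m → ι → ℤ) :
    gs (l.foldl (reduceAt i) b) = gs b ∧
    Submodule.span ℤ (Set.range (l.foldl (reduceAt i) b)) = Submodule.span ℤ (Set.range b) ∧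
    (∀ k ≠ i, l.foldl (reduceAt i) b k = b k) ∧
    (∀ k, (∀ j ∈ l, j < k) → mu (l.foldl (reduceAt i) b) i k = mu b i k) ∧
    ((∀ k, gs b k ≠ 0) → ∀ j ∈ l, |mu (l.foldl (reduceAt i) b) i j| ≤ 1 / 2) := by
  induction l generalizing b with
  | nil => simp
  | cons a t ih =>
    rw [List.pairwise_cons] at hl
    have ha : a < i := hi a (by simp)
    obtain ⟨h1, h2, h3, h4, h5⟩ := ih hl.2 (fun j hj => hi j (by simp [hj])) (reduceAt i b a)
    simp only [List.foldl_cons]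
    refine ⟨h1.trans (gs_reduceAt b ha), h2.trans (span_reduceAt b ha.ne), ?_, ?_, ?_⟩
    · intro k hk
      rw [h3 k hk, reduceAt, Function.update_of_ne hk]
    · intro k hk
      rw [h4 k fun j hj => hk j (by simp [hj]), mu_reduceAt_self b ha,
        mu_of_lt b (hk a (by simp)), mul_zero, sub_zero]
    · intro hb j hj
      rcases List.mem_cons.1 hj with rfl | hj
      · rw [h4 j hl.1, mu_reduceAt_self b ha, mu_self b (hb j), mul_one]
        exact abs_sub_round _
      · exact h5 (fun k => by rw [gs_reduceAt b ha]; exact hb k) j hj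

theorem reduceRow_spec (b : Fin m → ι → ℤ) (i : Fin m) :
    gs (reduceRow b i) = gs b ∧
    Submodule.span ℤ (Set.range (reduceRow b i)) = Submodule.span ℤ (Set.range b) ∧
    (∀ k ≠ i, reduceRow b i k = b k) ∧
    ((∀ k, gs b k ≠ 0) → ∀ j < i, |mu (reduceRow b i) i j| ≤ 1 / 2) := by
  have hs : (((List.finRange m).filter (· < i)).reverse).Pairwise (· > ·) := by
    rw [List.pairwise_reverse]
    exact (List.pairwise_lt_finRange m).filter _
  obtain ⟨h1, h2, h3, -, h5⟩ := foldl_reduceAt i _ hs (by simp) b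
  exact ⟨h1, h2, h3, fun hb j hj => h5 hb j (by simpa using hj)⟩

/-- The disjunction is the loop invariant: row `i` is still to be treated or already reduced.
Treating another row changes neither `b_i` nor any Gram–Schmidt vector, hence no `μ_{ij}`. -/
theorem foldl_reduceRow (l : List (Fin m)) (b : Fin m → ι → ℤ) :
    gs (l.foldl reduceRow b) = gs b ∧
    Submodule.span ℤ (Set.range (l.foldl reduceRow b)) = Submodule.span ℤ (Set.range b) ∧
    ((∀ k, gs b k ≠ 0) → ∀ i, (i ∈ l ∨ ∀ j < i, |mu b i j| ≤ 1 / 2) →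
      ∀ j < i, |mu (l.foldl reduceRow b) i j| ≤ 1 / 2) := by
  induction l generalizing b with
  | nil => simp
  | cons a t ih =>
    obtain ⟨h1, h2, h3⟩ := ih (reduceRow b a)
    obtain ⟨r1, r2, r3, r4⟩ := reduceRow_spec b a
    refine ⟨h1.trans r1, h2.trans r2, fun hb i hi => ?_⟩
    refine h3 (by rwa [r1]) i ?_
    by_cases hia : i = a
    · right
      rw [hia]
      exact r4 hb
    · rcases hi with hi | hi
      · left
        simpa [hia] using hi
      · right
        intro j hj
        rw [mu, r1, r3 i hia]
        exact hi j hj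

theorem sizeReduce_spec (b : Fin m → ι → ℤ) :
    gs (sizeReduce b) = gs b ∧
    Submodule.span ℤ (Set.range (sizeReduce b)) = Submodule.span ℤ (Set.range b) ∧
    ((∀ k, gs b k ≠ 0) → ∀ i, ∀ j < i, |mu (sizeReduce b) i j| ≤ 1 / 2) := by
  obtain ⟨h1, h2, h3⟩ := foldl_reduceRow (List.finRange m) b
  exact ⟨h1, h2, fun hb i => h3 hb i (Or.inl (by simp))⟩

/-! #### Linear independence -/

theorem gs_ne_zero {b : Fin m → ι → ℤ} (hb : LinearIndependent ℝ fun i => toEuclidean (b i))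
    (i : Fin m) : gs b i ≠ 0 :=
  InnerProductSpace.gramSchmidt_ne_zero i hb

/-! #### The potential -/

/-- The Gram determinant of the first `k` vectors. -/
noncomputable def gramDet (b : Fin m → ι → ℤ) (k : ℕ) : ℤ :=
  Matrix.det (Matrix.of fun i j : {i : Fin m // i.val < k} => ∑ l, b i l * b j l)

/-- The coefficients of the basis vectors with respect to the Gram–Schmidt vectors. -/
noncomputable def coeff (b : Fin m → ι → ℤ) (i j : Fin m) : ℝ :=
  if j = i then 1 else if j < i then
    inner ℝ (gs b j) (toEuclidean (b i)) / ‖gs b j‖ ^ 2 else 0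

theorem toEuclidean_eq_sum (b : Fin m → ι → ℤ) (k : ℕ) (i : {i : Fin m // i.val < k}) :
    toEuclidean (b i) = ∑ j : {i : Fin m // i.val < k}, coeff b i j • gs b j := by
  have h := InnerProductSpace.gramSchmidt_def'' ℝ (fun i => toEuclidean (b i)) i
  have h1 : ∑ j : {i : Fin m // i.val < k}, coeff b i j • gs b j =
      ∑ j ∈ Finset.univ.filter (fun i : Fin m => i.val < k), coeff b i j • gs b j :=
    (Finset.sum_subtype _ (by simp) fun j => coeff b i j • gs b j).symm
  have h2 : ∑ j ∈ Finset.Iic i.1, coeff b i j • gs b j =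
      ∑ j ∈ Finset.univ.filter (fun i : Fin m => i.val < k), coeff b i j • gs b j := by
    refine Finset.sum_subset ?_ ?_
    · intro j hj
      have : j ≤ i.1 := Finset.mem_Iic.1 hj
      simpa using lt_of_le_of_lt (Fin.le_def.1 this) i.2
    · intro j _ hj
      have hj' : i.1 < j := by simpa using hj
      rw [coeff, if_neg hj'.ne', if_neg hj'.not_gt, zero_smul]
  rw [h1, ← h2, ← Finset.Iio_insert, Finset.sum_insert (by simp)]
  refine h.trans ?_
  congr 1
  · simp [coeff, gs]
  · refine Finset.sum_congr rfl fun j hj => ?_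
    have hj' : j < i.1 := Finset.mem_Iio.1 hj
    rw [coeff, if_neg hj'.ne, if_pos hj']
    rfl

/-- The Gram matrix factors as `U D Uᵀ`, with `U` unit lower triangular and `D` the diagonal of
squared Gram–Schmidt norms. An integer thereby becomes a product of real lengths, which is what
makes the potential both discrete and computable. -/
theorem cast_gramDet (b : Fin m → ι → ℤ) (k : ℕ) :
    (gramDet b k : ℝ) = ∏ i : {i : Fin m // i.val < k}, ‖gs b i‖ ^ 2 := by
  let U : Matrix {i : Fin m // i.val < k} {i : Fin m // i.val < k} ℝ :=
    Matrix.of fun i j => coeff b i j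
  have hU : U.det = 1 := by
    rw [Matrix.det_of_isLowerTriangular U]
    · simp [U, coeff]
    · intro i j hij
      have hij' : i.1 < j.1 := hij
      simp only [U, coeff, Matrix.of_apply, if_neg hij'.ne', if_neg hij'.not_gt]
  have hG : (Matrix.of fun i j : {i : Fin m // i.val < k} => ∑ l, b i l * b j l).map
      (Int.castRingHom ℝ) =
      U * Matrix.diagonal (fun i : {i : Fin m // i.val < k} => ‖gs b i‖ ^ 2) * U.transpose := by
    ext i j
    rw [Matrix.map_apply, Matrix.of_apply]
    change ((∑ l, b i l * b j l : ℤ) : ℝ) = _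
    rw [← inner_toEuclidean, toEuclidean_eq_sum b k i, toEuclidean_eq_sum b k j, Matrix.mul_apply]
    simp only [Matrix.mul_diagonal, Matrix.transpose_apply, U, Matrix.of_apply, sum_inner,
      inner_sum, inner_smul_left, inner_smul_right]
    refine Finset.sum_congr rfl fun l _ => ?_
    rw [Finset.sum_eq_single l]
    · rw [real_inner_self_eq_norm_sq]
      simp
      ring
    · intro l' _ hl
      rw [gs_orthogonal b (fun h => hl (Subtype.ext h))]
      simp
    · simp
  have := congrArg Matrix.det hG
  rw [← RingHom.mapMatrix_apply, ← RingHom.map_det, Matrix.det_mul, Matrix.det_mul, Matrix.det_transpose, hU,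
    Matrix.det_diagonal] at this
  simpa [gramDet] using this

theorem gramDet_pos {b : Fin m → ι → ℤ} (hb : ∀ i, gs b i ≠ 0) (k : ℕ) : 0 < gramDet b k := by
  have : (0 : ℝ) < gramDet b k := by
    rw [cast_gramDet]
    exact Finset.prod_pos fun i _ => pow_pos (norm_pos_iff.2 (hb i)) 2
  exact_mod_cast this

theorem gramDet_congr {b b' : Fin m → ι → ℤ} (h : gs b' = gs b) (k : ℕ) :
    gramDet b' k = gramDet b k := by
  have : (gramDet b' k : ℝ) = gramDet b k := by rw [cast_gramDet, cast_gramDet, h]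
  exact_mod_cast this

theorem prev_lt {i : Fin m} (hi : 0 < i.val) : prev i < i := by
  rw [Fin.lt_def, prev]
  simp only
  omega

/-- For `k ≠ i` the indices `i - 1` and `i` lie both inside or both outside the first `k`, so the
swap only renumbers the rows and columns of the Gram matrix. -/
theorem gramDet_swap_of_ne (b : Fin m → ι → ℤ) {i : Fin m} {k : ℕ} (hk : k ≠ i.val) :
    gramDet (fun j => b (Equiv.swap (prev i) i j)) k = gramDet b k := by
  have hp : ∀ x, (Equiv.swap (prev i) i x).val < k ↔ x.val < k := by
    intro x
    rcases eq_or_ne x (prev i) with rfl | h1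
    · rw [Equiv.swap_apply_left]
      simp only [prev]
      omega
    rcases eq_or_ne x i with rfl | h2
    · rw [Equiv.swap_apply_right]
      simp only [prev]
      omega
    · rw [Equiv.swap_apply_of_ne_of_ne h1 h2]
  have := Matrix.det_submatrix_equiv_self ((Equiv.swap (prev i) i).subtypePerm hp)
    (Matrix.of fun i j : {i : Fin m // i.val < k} => ∑ l, b i l * b j l)
  rw [gramDet, gramDet, ← this]
  rfl

theorem gs_congr_of_lt {b b' : Fin m → ι → ℤ} {k : Fin m} (h : ∀ i ≤ k, b' i = b i) :
    gs b' k = gs b k := by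
  induction k using WellFoundedLT.induction with
  | ind k ih =>
    have ih' : ∀ j < k, gs b' j = gs b j := fun j hj => ih j hj fun i hi => h i (hi.trans hj.le)
    have himg : gs b' '' Set.Iio k = gs b '' Set.Iio k := Set.image_congr fun j hj => ih' j hj
    refine eq_gs_of_sub_mem b k _ ?_ fun j hj => ?_
    · have h1 := gs_sub_mem b' k
      rwa [himg, h k le_rfl] at h1
    · rw [← ih' j hj]
      exact gs_orthogonal b' (ne_of_lt hj)

/-- The orthogonalised vector at position `i - 1` after exchanging the vectors `i - 1` and `i`. -/
theorem gs_swap_prev (b : Fin m → ι → ℤ) {i : Fin m} (hi : 0 < i.val) :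
    gs (fun j => b (Equiv.swap (prev i) i j)) (prev i) =
      gs b i + mu b i (prev i) • gs b (prev i) := by
  symm
  have hlt : ∀ j < prev i, ∀ l ≤ j, b (Equiv.swap (prev i) i l) = b l := by
    intro j hj l hl
    have h1 : l < prev i := lt_of_le_of_lt hl hj
    rw [Equiv.swap_apply_of_ne_of_ne h1.ne (h1.trans (prev_lt hi)).ne]
  have hgs : ∀ j < prev i, gs (fun j => b (Equiv.swap (prev i) i j)) j = gs b j := fun j hj =>
    gs_congr_of_lt (hlt j hj)
  refine eq_gs_of_sub_mem _ _ _ ?_ fun j hj => ?_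
  · have himg : gs (fun j => b (Equiv.swap (prev i) i j)) '' Set.Iio (prev i) =
        gs b '' Set.Iio (prev i) := Set.image_congr fun j hj => hgs j hj
    rw [himg, Equiv.swap_apply_left]
    have h := InnerProductSpace.gramSchmidt_def'' ℝ (fun i => toEuclidean (b i)) i
    have hI : Finset.Iio i = insert (prev i) (Finset.Iio (prev i)) := by
      ext l
      simp only [Finset.mem_Iio, Finset.mem_insert, Fin.lt_def, Fin.ext_iff, prev]
      omega
    rw [hI, Finset.sum_insert (by simp)] at h
    have h' : toEuclidean (b i) = gs b i + (mu b i (prev i) • gs b (prev i) +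
        ∑ j ∈ Finset.Iio (prev i),
          (inner ℝ (gs b j) (toEuclidean (b i)) / (‖gs b j‖ : ℝ) ^ 2) • gs b j) := by
      rw [mu, real_inner_comm]
      exact h
    rw [h', ← add_assoc, sub_add_cancel_left]
    refine Submodule.neg_mem _ (Submodule.sum_mem _ fun j hj => Submodule.smul_mem _ _ ?_)
    exact Submodule.subset_span ⟨j, Finset.mem_Iio.1 hj, rfl⟩
  · rw [hgs j hj, inner_add_right, inner_smul_right, gs_orthogonal b hj.ne,
      gs_orthogonal b (hj.trans (prev_lt hi)).ne]
    simp

/-- Only the last factor of the product changes, from `‖b*_{i-1}‖²` to `‖b*_i‖² + μ² ‖b*_{i-1}‖²`;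
the failure of the Lovász condition makes the latter less than `3 / 4` of the former. -/
theorem gramDet_swap_lt {b : Fin m → ι → ℤ} (hb : ∀ i, gs b i ≠ 0) {i : Fin m}
    (hi : LovaszFails b i) :
    gramDet (fun j => b (Equiv.swap (prev i) i j)) i.val < gramDet b i.val := by
  obtain ⟨h0, h1⟩ := hi
  have : (gramDet (fun j => b (Equiv.swap (prev i) i j)) i.val : ℝ) < gramDet b i.val := by
    rw [cast_gramDet, cast_gramDet]
    let q : {j : Fin m // j.val < i.val} := ⟨prev i, prev_lt h0⟩
    rw [← Finset.mul_prod_erase _ _ (Finset.mem_univ q),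
      ← Finset.mul_prod_erase _ (fun i => ‖gs b i.1‖ ^ 2) (Finset.mem_univ q)]
    have heq : ∏ j ∈ Finset.univ.erase q,
        ‖gs (fun j => b (Equiv.swap (prev i) i j)) j.1‖ ^ 2 =
        ∏ j ∈ Finset.univ.erase q, ‖gs b j.1‖ ^ 2 := by
      refine Finset.prod_congr rfl fun j hj => ?_
      have hj1 : j ≠ q := (Finset.mem_erase.1 hj).1
      have hj2 : j.1 < prev i := by
        refine lt_of_le_of_ne ?_ fun h => hj1 (Subtype.ext h)
        have := j.2
        rw [Fin.le_def, prev]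
        simp only
        omega
      rw [gs_congr_of_lt (b := b) fun l hl => ?_]
      have h1 : l < prev i := lt_of_le_of_lt hl hj2
      rw [Equiv.swap_apply_of_ne_of_ne h1.ne (h1.trans (prev_lt h0)).ne]
    rw [heq]
    refine mul_lt_mul_of_pos_right ?_
      (Finset.prod_pos fun j _ => pow_pos (norm_pos_iff.2 (hb j)) 2)
    change ‖gs (fun j => b (Equiv.swap (prev i) i j)) (prev i)‖ ^ 2 < ‖gs b (prev i)‖ ^ 2
    rw [gs_swap_prev b h0, sq, norm_add_sq_eq_norm_sq_add_norm_sq_real, norm_smul]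
    · have h2 : 0 < ‖gs b (prev i)‖ ^ 2 := pow_pos (norm_pos_iff.2 (hb _)) 2
      have h3 : |mu b i (prev i)| ^ 2 = mu b i (prev i) ^ 2 := sq_abs _
      rw [Real.norm_eq_abs]
      nlinarith
    · rw [inner_smul_right, gs_orthogonal b (prev_lt h0).ne', mul_zero]
  exact_mod_cast this

/-- The potential: the product of all Gram determinants. -/
noncomputable def potential (b : Fin m → ι → ℤ) : ℕ := ∏ k : Fin m, (gramDet b k.val).toNat

theorem step_spec {b : Fin m → ι → ℤ} (hb : LinearIndependent ℝ fun i => toEuclidean (b i)) :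
    Submodule.span ℤ (Set.range (step b)) = Submodule.span ℤ (Set.range b) ∧
    (¬ Stops b → potential (step b) < potential b) := by
  obtain ⟨h1, h2, -⟩ := sizeReduce_spec b
  cases hf : firstFailure (sizeReduce b) with
  | none =>
    have : step b = sizeReduce b := by simp [step, hf]
    exact ⟨by rw [this, h2], fun h => absurd hf h⟩
  | some i =>
    have hs : step b = fun j => sizeReduce b (Equiv.swap (prev i) i j) := by simp [step, hf]
    have hi : LovaszFails (sizeReduce b) i := by
      have := List.find?_some hf
      simpa using this
    have hspan : Submodule.span ℤ (Set.range (step b)) = Submodule.span ℤ (Set.range b) := by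
      rw [← h2, hs]
      congr 1
      exact (Equiv.swap (prev i) i).surjective.range_comp (sizeReduce b)
    refine ⟨hspan, fun _ => ?_⟩
    have hgs : ∀ k, gs (sizeReduce b) k ≠ 0 := by rw [h1]; exact gs_ne_zero hb
    have hgs' : ∀ k, gs (step b) k ≠ 0 := gs_ne_zero (linearIndependent_of_span_eq hspan hb)
    have hle : ∀ k : ℕ, k ≠ i.val → gramDet (step b) k = gramDet b k := fun k hk => by
      rw [hs, gramDet_swap_of_ne _ hk, gramDet_congr h1]
    have hlt : gramDet (step b) i.val < gramDet b i.val := by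
      rw [hs, ← gramDet_congr h1]
      exact gramDet_swap_lt hgs hi
    refine Finset.prod_lt_prod (fun k _ => ?_) (fun k _ => ?_) ⟨i, Finset.mem_univ _, ?_⟩
    · have := gramDet_pos hgs' k.val
      omega
    · by_cases hk : k.val = i.val
      · rw [hk]
        omega
      · rw [hle _ hk]
    · have := gramDet_pos hgs' i.val
      omega

theorem iterate_step_spec {b : Fin m → ι → ℤ}
    (hb : LinearIndependent ℝ fun i => toEuclidean (b i)) (t : ℕ) :
    Submodule.span ℤ (Set.range (step^[t] b)) = Submodule.span ℤ (Set.range b) := by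
  induction t with
  | zero => rfl
  | succ t ih =>
    rw [Function.iterate_succ_apply']
    exact (step_spec (linearIndependent_of_span_eq ih hb)).1.trans ih

/-- The potential is a natural number that drops at every round that does not stop. -/
theorem exists_stops {b : Fin m → ι → ℤ}
    (hb : LinearIndependent ℝ fun i => toEuclidean (b i)) : ∃ t : ℕ, Stops (step^[t] b) := by
  by_contra! h
  have hdec : ∀ t, potential (step^[t] b) + t ≤ potential b := by
    intro t
    induction t with
    | zero => simp
    | succ t ih =>
      have := (step_spec (linearIndependent_of_span_eq (iterate_step_spec hb t) hb)).2 (h t)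
      rw [Function.iterate_succ_apply']
      omega
  have := hdec (potential b + 1)
  omega

/-! #### The length of the first vector -/

/-- With `μ² ≤ 1 / 4` the Lovász condition leaves the factor `3 / 4 - 1 / 4 = 1 / 2`, so squared
Gram–Schmidt norms at most halve from one index to the next. -/
theorem norm_gs_zero_le {b : Fin m → ι → ℤ} (hμ : ∀ i, ∀ j < i, |mu b i j| ≤ 1 / 2)
    (hL : ∀ i, ¬ LovaszFails b i) (hm : 0 < m) (k : ℕ) (hk : k < m) :
    ‖gs b ⟨0, hm⟩‖ ^ 2 ≤ 2 ^ k * ‖gs b ⟨k, hk⟩‖ ^ 2 := by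
  induction k with
  | zero => simp
  | succ k ih =>
    have h1 := ih (by omega)
    have h2 := hL ⟨k + 1, hk⟩
    have hp : prev (⟨k + 1, hk⟩ : Fin m) = ⟨k, by omega⟩ := by simp [prev]
    rw [LovaszFails, hp, not_and, not_lt] at h2
    have h3 := h2 (by simp)
    have h4 := hμ ⟨k + 1, hk⟩ ⟨k, by omega⟩ (by simp [Fin.lt_def])
    have h5 : mu b ⟨k + 1, hk⟩ ⟨k, by omega⟩ ^ 2 ≤ 1 / 4 := by
      rw [← sq_abs]
      nlinarith [abs_nonneg (mu b ⟨k + 1, hk⟩ ⟨k, by omega⟩)]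
    have h6 : ‖gs b ⟨k, by omega⟩‖ ^ 2 ≤ 2 * ‖gs b ⟨k + 1, hk⟩‖ ^ 2 := by
      nlinarith [sq_nonneg ‖gs b ⟨k, by omega⟩‖]
    calc _ ≤ _ := h1
      _ ≤ 2 ^ k * (2 * ‖gs b ⟨k + 1, hk⟩‖ ^ 2) := by gcongr
      _ = _ := by ring

/-- Take `k` to be the last index with a nonzero coefficient. Then `⟨x, b*_k⟩ = a_k ‖b*_k‖²` with
`|a_k| ≥ 1`, and Cauchy–Schwarz concludes. -/
theorem exists_norm_gs_le {b : Fin m → ι → ℤ} {x : ι → ℤ}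
    (hx : x ∈ Submodule.span ℤ (Set.range b)) (hx0 : x ≠ 0) :
    ∃ k, ‖gs b k‖ ≤ ‖toEuclidean x‖ := by
  obtain ⟨a, rfl⟩ := (Submodule.mem_span_range_iff_exists_fun ℤ).1 hx
  have hne : (Finset.univ.filter fun i => a i ≠ 0).Nonempty := by
    by_contra h
    rw [Finset.not_nonempty_iff_eq_empty, Finset.filter_eq_empty_iff] at h
    refine hx0 (Finset.sum_eq_zero fun i _ => ?_)
    rw [not_not.1 (h (Finset.mem_univ i)), zero_smul]
  set k := (Finset.univ.filter fun i => a i ≠ 0).max' hne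
  have hk : a k ≠ 0 := (Finset.mem_filter.1 (Finset.max'_mem _ hne)).2
  have hgt : ∀ i, k < i → a i = 0 := by
    intro i hi
    by_contra h
    exact absurd (Finset.le_max' _ i (by simpa using h)) (not_le.2 hi)
  refine ⟨k, ?_⟩
  have hin : inner ℝ (toEuclidean (∑ i, a i • b i)) (gs b k) = a k * ‖gs b k‖ ^ 2 := by
    rw [toEuclidean_sum, sum_inner, Finset.sum_eq_single k]
    · rw [toEuclidean_smul, inner_smul_left, inner_toEuclidean_gs_self]
      simp
    · intro i _ hi
      rw [toEuclidean_smul, inner_smul_left]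
      rcases lt_or_gt_of_ne hi with h | h
      · rw [real_inner_comm, inner_gs_toEuclidean_of_lt b h, mul_zero]
      · rw [hgt i h]
        simp
    · simp
  have hcs := abs_real_inner_le_norm (toEuclidean (∑ i, a i • b i)) (gs b k)
  rw [hin, abs_mul, abs_of_nonneg (sq_nonneg ‖gs b k‖)] at hcs
  have h1 : (1 : ℝ) ≤ |(a k : ℝ)| := by exact_mod_cast Int.one_le_abs hk
  rcases (norm_nonneg (gs b k)).eq_or_lt with h0 | h0
  · rw [← h0]
    exact norm_nonneg _
  · have : ‖gs b k‖ * ‖gs b k‖ ≤ ‖toEuclidean (∑ i, a i • b i)‖ * ‖gs b k‖ := by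
      nlinarith [sq_nonneg ‖gs b k‖]
    exact le_of_mul_le_mul_right this h0

/-- All that is needed about LLL. The first reduced vector is its own Gram–Schmidt vector, so the
two preceding bounds combine into an approximation factor `2 ^ m` for squared lengths. -/
theorem output_spec {b : Fin m → ι → ℤ} (hm : 0 < m)
    (hb : LinearIndependent ℝ fun i => toEuclidean (b i)) :
    output b ∈ Submodule.span ℤ (Set.range b) ∧ output b ≠ 0 ∧
      ∀ x ∈ Submodule.span ℤ (Set.range b), x ≠ 0 →
        ‖toEuclidean (output b)‖ ^ 2 ≤ 2 ^ m * ‖toEuclidean x‖ ^ 2 := by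
  classical
  have hst := exists_stops hb
  set c := step^[Nat.find hst] b with hc
  have hcs : Submodule.span ℤ (Set.range c) = Submodule.span ℤ (Set.range b) :=
    iterate_step_spec hb _
  have hcl := linearIndependent_of_span_eq hcs hb
  obtain ⟨h1, h2, h3⟩ := sizeReduce_spec c
  have hout : output b = sizeReduce c ⟨0, hm⟩ := by
    rw [output, dif_pos hm, reducedBasis, dif_pos hst, hc]
  have hnone : firstFailure (sizeReduce c) = none := Nat.find_spec hst
  have hL : ∀ i, ¬ LovaszFails (sizeReduce c) i := by
    intro i
    have := List.find?_eq_none.1 hnone i (by simp)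
    simpa using this
  have hspan := h2.trans hcs
  have hrl := linearIndependent_of_span_eq hspan hb
  have h0 : gs (sizeReduce c) ⟨0, hm⟩ = toEuclidean (sizeReduce c ⟨0, hm⟩) := by
    have := gs_sub_mem (sizeReduce c) ⟨0, hm⟩
    have he : Set.Iio (⟨0, hm⟩ : Fin m) = ∅ := by
      ext j
      simp [Fin.lt_def]
    rw [he, Set.image_empty, Submodule.span_empty, Submodule.mem_bot] at this
    exact sub_eq_zero.1 this
  rw [hout]
  refine ⟨?_, ?_, fun x hx hx0 => ?_⟩
  · rw [← hspan]
    exact Submodule.subset_span ⟨_, rfl⟩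
  · intro h
    refine gs_ne_zero hrl ⟨0, hm⟩ ?_
    rw [h0, h]
    ext i
    simp [toEuclidean]
  · rw [← hspan] at hx
    obtain ⟨k, hk⟩ := exists_norm_gs_le hx hx0
    rw [← h0]
    calc _ ≤ 2 ^ k.val * ‖gs (sizeReduce c) k‖ ^ 2 :=
          norm_gs_zero_le (h3 (gs_ne_zero hcl)) hL hm k.val k.2
      _ ≤ 2 ^ m * ‖toEuclidean x‖ ^ 2 := by
          gcongr
          · norm_num
          · exact k.2.le

end LLL

/-! ### Deterministic analysis of the ELO algorithm -/

namespace ELO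

variable {n p : ℕ}

theorem three_le_abs_modified (Y : Fin n → ℤ) (X : Fin n → Fin p → ℤ) (Z : Fin p → ℤ)
    (i : Fin n) : 3 ≤ |modified Y X Z i| := by
  unfold modified
  split_ifs with h
  · simp
  · exact not_lt.1 h

theorem abs_le_abs_modified (Y : Fin n → ℤ) (X : Fin n → Fin p → ℤ) (Z : Fin p → ℤ)
    (i : Fin n) : |Y i + ∑ j, X i j * Z j| ≤ |modified Y X Z i| := by
  unfold modified
  split_ifs with h
  · exact h.le
  · exact le_rfl

theorem abs_modified_sub_le (Y : Fin n → ℤ) (X : Fin n → Fin p → ℤ) (Z : Fin p → ℤ)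
    (i : Fin n) : |modified Y X Z i - (Y i + ∑ j, X i j * Z j)| ≤ 5 := by
  unfold modified
  split_ifs with h
  · rw [abs_lt] at h
    rw [abs_le]
    omega
  · simp

/-! ### Lattice vectors written block by block. -/

section Columns

variable {S : Type*} [CommRing S] (m : ℤ) (X : Fin n → Fin p → ℤ) (Y₂ : Fin n → ℤ)
  (g : Fin (p + n + n) → S)

theorem sum_columns_inl (i : Fin n) :
    ∑ k, g k * ((columns m X Y₂ k (Sum.inl i) : ℤ) : S) =
      m * (∑ j, X i j * g (Fin.castAdd n (Fin.castAdd n j))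
        - Y₂ i * g (Fin.castAdd n (Fin.natAdd p i)) + g (Fin.natAdd (p + n) i)) := by
  simp only [Fin.sum_univ_add, columns, Fin.append_left, Fin.append_right, Sum.elim_inl,
    Int.cast_ite, Int.cast_zero, mul_ite, mul_zero, Finset.sum_ite_eq, Finset.mem_univ, if_true]
  rw [mul_add, mul_sub, Finset.mul_sum]
  push_cast
  congr 1
  · rw [sub_eq_add_neg]
    congr 1
    · exact Finset.sum_congr rfl fun j _ => by ring
    · ring
  · ring

theorem sum_columns_inr_inl (j : Fin p) :
    ∑ k, g k * ((columns m X Y₂ k (Sum.inr (Sum.inl j)) : ℤ) : S) =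
      g (Fin.castAdd n (Fin.castAdd n j)) := by
  simp [Fin.sum_univ_add, columns, Fin.append_left, Fin.append_right]

theorem sum_columns_inr_inr (i : Fin n) :
    ∑ k, g k * ((columns m X Y₂ k (Sum.inr (Sum.inr i)) : ℤ) : S) =
      g (Fin.natAdd (p + n) i) := by
  simp [Fin.sum_univ_add, columns, Fin.append_left, Fin.append_right]

end Columns

theorem linearIndependent_columns {m : ℤ} (hm : m ≠ 0) (X : Fin n → Fin p → ℤ) {Y₂ : Fin n → ℤ}
    (hY : ∀ i, Y₂ i ≠ 0) :
    LinearIndependent ℝ fun k => LLL.toEuclidean (columns m X Y₂ k) := by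
  rw [Fintype.linearIndependent_iff]
  intro g hg
  have hr : ∀ r, ∑ k, g k * ((columns m X Y₂ k r : ℤ) : ℝ) = 0 := by
    intro r
    have := congrArg (fun x : EuclideanSpace ℝ _ => x r) hg
    simpa [LLL.toEuclidean] using this
  have h1 : ∀ j, g (Fin.castAdd n (Fin.castAdd n j)) = 0 := fun j => by
    rw [← sum_columns_inr_inl m X Y₂ g j, hr]
  have h2 : ∀ i, g (Fin.natAdd (p + n) i) = 0 := fun i => by
    rw [← sum_columns_inr_inr m X Y₂ g i, hr]
  have h3 : ∀ i, g (Fin.castAdd n (Fin.natAdd p i)) = 0 := fun i => by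
    have := sum_columns_inl m X Y₂ g i
    rw [hr, h2] at this
    simpa [h1, hm, hY i] using this.symm
  intro k
  refine Fin.addCases (fun k => ?_) h2 k
  exact Fin.addCases h1 h3 k

/-- The unsigned gcd is `|l|`; as the entries of `β` have a positive sum, the sign of `∑ l β_j` is
that of `l`. -/
theorem signedGcd_mul {l : ℤ} {β : Fin p → ℤ} (hp : 0 < p) (hβ : ∀ j, 0 < β j)
    (hgcd : Finset.univ.gcd β = 1) : signedGcd (fun j => l * β j) = l := by
  have hs : 0 < ∑ j, β j := by
    have : Nonempty (Fin p) := ⟨⟨0, hp⟩⟩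
    exact Finset.sum_pos (fun j _ => hβ j) Finset.univ_nonempty
  have hg : Finset.univ.gcd (fun j => l * β j) = |l| := by
    rw [Finset.gcd_mul_left, hgcd, mul_one, Int.abs_eq_normalize]
  rw [signedGcd, hg, ← Finset.mul_sum]
  split_ifs with h
  · have : l < 0 := by
      by_contra h'
      exact absurd h (not_lt.2 (mul_nonneg (not_lt.1 h') hs.le))
    rw [abs_of_neg this, neg_neg]
  · have : 0 ≤ l := by
      by_contra h'
      exact h (mul_neg_of_neg_of_pos (not_le.1 h') hs)
    exact abs_of_nonneg this

/-- The ELO algorithm recovers `b` if all short integer relations are multiples of `b + Z`. -/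
theorem run_eq (hp : 0 < p) (Y : Fin n → ℤ) (X : Fin n → Fin p → ℤ) (Rhat What : ℕ)
    (Z b : Fin p → ℤ) (A : ℕ) (hA : A < multiplier n p Rhat What)
    (hpos : ∀ j, 0 < b j + Z j) (hgcd : Finset.univ.gcd (fun j => b j + Z j) = 1)
    (hshort : (2 : ℝ) ^ (p + n + n) * (∑ j, ((b j + Z j : ℤ) : ℝ) ^ 2 +
      ∑ i, ((modified Y X Z i - ∑ j, X i j * (b j + Z j) : ℤ) : ℝ) ^ 2) ≤ (A : ℝ) ^ 2)
    (hrel : ∀ (v : Fin p → ℤ) (y w : Fin n → ℤ), (∀ j, |v j| ≤ A) → (∀ i, |w i| ≤ A) →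
      (∀ i, ∑ j, X i j * v j - modified Y X Z i * y i + w i = 0) → (v ≠ 0 ∨ w ≠ 0) →
      ∃ l : ℤ, l ≠ 0 ∧ ∀ j, v j = l * (b j + Z j)) :
    run Y X Rhat What Z = fun j => (b j : ℝ) := by
  set m : ℤ := (multiplier n p Rhat What : ℤ) with hm
  set Y₂ := modified Y X Z with hY₂
  have hm0 : m ≠ 0 := by omega
  have hY0 : ∀ i, Y₂ i ≠ 0 := fun i h => by
    have := three_le_abs_modified Y X Z i
    rw [← hY₂, h] at this
    simp at this
  obtain ⟨hmem, hne, hle⟩ := LLL.output_spec (by omega) (linearIndependent_columns hm0 X hY0)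
  set z := LLL.output (columns m X Y₂) with hz
  have eval : ∀ (a : Fin (p + n + n) → ℤ) (r), (∑ k, a k • columns m X Y₂ k) r =
      ∑ k, a k * (Int.cast (columns m X Y₂ k r) : ℤ) := by
    intro a r
    simp
  -- the target vector
  set w₂ : Fin n → ℤ := fun i => Y₂ i - ∑ j, X i j * (b j + Z j) with hw₂
  -- Coefficient `1` on every diagonal column and the residual `w₂` on the last block cancel the
  -- first block exactly.
  let a₀ : Fin (p + n + n) → ℤ := Fin.append (Fin.append (fun j => b j + Z j) fun _ => 1) w₂
  have hx1 : ∀ i, (∑ k, a₀ k • columns m X Y₂ k) (Sum.inl i) = 0 := fun i => by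
    rw [eval, sum_columns_inl]
    simp [a₀, hw₂]
  have hx2 : ∀ j, (∑ k, a₀ k • columns m X Y₂ k) (Sum.inr (Sum.inl j)) = b j + Z j := fun j => by
    rw [eval, sum_columns_inr_inl]
    simp [a₀]
  have hx3 : ∀ i, (∑ k, a₀ k • columns m X Y₂ k) (Sum.inr (Sum.inr i)) = w₂ i := fun i => by
    rw [eval, sum_columns_inr_inr]
    simp [a₀]
  have hxle := hle (∑ k, a₀ k • columns m X Y₂ k)
    (Submodule.sum_mem _ fun k _ => Submodule.smul_mem _ _ (Submodule.subset_span ⟨k, rfl⟩))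
    (fun h => by
      have h1 := hx2 ⟨0, hp⟩
      rw [h] at h1
      exact (hpos ⟨0, hp⟩).ne h1)
  have hznorm : ∑ r, (z r : ℝ) ^ 2 ≤ (A : ℝ) ^ 2 := by
    rw [← LLL.norm_toEuclidean_sq]
    refine hxle.trans (le_trans (le_of_eq ?_) hshort)
    rw [LLL.norm_toEuclidean_sq, Fintype.sum_sum_type, Fintype.sum_sum_type]
    simp only [hx1, hx2, hx3, hw₂]
    simp
  have hzA : ∀ r, |z r| ≤ A := by
    intro r
    have h1 : (z r : ℝ) ^ 2 ≤ (A : ℝ) ^ 2 :=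
      (Finset.single_le_sum (f := fun r => (z r : ℝ) ^ 2) (fun r _ => sq_nonneg _)
        (Finset.mem_univ r)).trans hznorm
    have h2 : |(z r : ℝ)| ≤ A := abs_le_of_sq_le_sq h1 (Nat.cast_nonneg A)
    exact_mod_cast h2
  obtain ⟨a, ha⟩ := (Submodule.mem_span_range_iff_exists_fun ℤ).1 hmem
  have hz1 : ∀ i, z (Sum.inl i) = m * (∑ j, X i j * a (Fin.castAdd n (Fin.castAdd n j))
        - Y₂ i * a (Fin.castAdd n (Fin.natAdd p i)) + a (Fin.natAdd (p + n) i)) := fun i => by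
    rw [← ha, eval, sum_columns_inl]
    simp
  have hz2 : ∀ j, z (Sum.inr (Sum.inl j)) = a (Fin.castAdd n (Fin.castAdd n j)) := fun j => by
    rw [← ha, eval, sum_columns_inr_inl]
  have hz3 : ∀ i, z (Sum.inr (Sum.inr i)) = a (Fin.natAdd (p + n) i) := fun i => by
    rw [← ha, eval, sum_columns_inr_inr]
  -- The entries of the first block are multiples of `m > A` of absolute value at most `A`, hence
  -- zero.
  have heq : ∀ i, ∑ j, X i j * a (Fin.castAdd n (Fin.castAdd n j))
        - Y₂ i * a (Fin.castAdd n (Fin.natAdd p i)) + a (Fin.natAdd (p + n) i) = 0 := by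
    intro i
    by_contra h
    have h1 := hzA (Sum.inl i)
    rw [hz1, abs_mul] at h1
    have h2 := Int.one_le_abs h
    have h3 : m ≤ |m| := le_abs_self m
    have h4 : |m| * 1 ≤ A := (mul_le_mul_of_nonneg_left h2 (abs_nonneg m)).trans h1
    omega
  obtain ⟨l, hl0, hl⟩ := hrel (fun j => a (Fin.castAdd n (Fin.castAdd n j)))
    (fun i => a (Fin.castAdd n (Fin.natAdd p i))) (fun i => a (Fin.natAdd (p + n) i))
    (fun j => by rw [← hz2]; exact hzA _) (fun i => by rw [← hz3]; exact hzA _) heq (by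
      by_contra! h
      refine hne (funext fun r => ?_)
      rcases r with i | j | i
      · rw [hz1, heq, mul_zero]; rfl
      · rw [hz2]; exact congrFun h.1 j
      · rw [hz3]; exact congrFun h.2 i)
  have hv : (fun j : Fin p => z (Sum.inr (Sum.inl j))) = fun j => l * (b j + Z j) :=
    funext fun j => (hz2 j).trans (hl j)
  have hg : signedGcd (fun j : Fin p => z (Sum.inr (Sum.inl j))) = l := by
    rw [hv, signedGcd_mul hp hpos hgcd]
  have hrun : run Y X Rhat What Z =
      if signedGcd (fun j : Fin p => z (Sum.inr (Sum.inl j))) ≠ 0 then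
        fun j => (z (Sum.inr (Sum.inl j)) : ℝ) /
          (signedGcd (fun j : Fin p => z (Sum.inr (Sum.inl j))) : ℝ) - (Z j : ℝ) else 0 := rfl
  rw [hrun, hg, if_pos hl0]
  funext j
  rw [show z (Sum.inr (Sum.inl j)) = l * (b j + Z j) from congrFun hv j]
  have : (l : ℝ) ≠ 0 := by exact_mod_cast hl0
  push_cast
  field_simp
  ring

end ELO

namespace LBR

variable {n p : ℕ}

/-! ### Truncation errors and the deterministic conditions for recovery. -/

theorem abs_trunc_sub_le (N : ℕ) (x : ℝ) : |(trunc N x : ℝ) - 2 ^ N * x| ≤ 1 := by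
  have h1 := Int.floor_le (2 ^ N * |x|)
  have h2 := (Int.lt_floor_add_one (2 ^ N * |x|)).le
  unfold trunc
  rcases lt_trichotomy x 0 with h | rfl | h
  · rw [sign_neg h, abs_le]
    rw [abs_of_neg h] at h1 h2 ⊢
    simp only [SignType.coe_neg_one, Int.cast_mul, Int.cast_neg, Int.cast_one]
    constructor <;> linarith
  · simp
  · rw [sign_pos h, abs_le]
    rw [abs_of_pos h] at h1 h2 ⊢
    simp only [SignType.coe_one, Int.cast_mul, Int.cast_one]
    constructor <;> linarith

theorem abs_trunc_le (N : ℕ) (x : ℝ) : |(trunc N x : ℝ)| ≤ 2 ^ N * |x| := by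
  have h0 : (0 : ℝ) ≤ 2 ^ N * |x| := by positivity
  have h1 := Int.floor_le (2 ^ N * |x|)
  have h3 : (0 : ℝ) ≤ ⌊2 ^ N * |x|⌋ := by exact_mod_cast Int.floor_nonneg.2 h0
  unfold trunc
  push_cast
  rw [abs_mul, abs_of_nonneg h3]
  rcases lt_trichotomy x 0 with h | rfl | h
  · rw [sign_neg h]
    simpa using h1
  · simp
  · rw [sign_pos h]
    simpa using h1

theorem abs_sum_trunc_sub_le (N : ℕ) (x : Fin p → ℝ) (u : Fin p → ℤ) (M : ℝ)
    (hu : ∀ j, |(u j : ℝ)| ≤ M) :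
    |∑ j, (trunc N (x j) : ℝ) * u j - 2 ^ N * ∑ j, x j * u j| ≤ p * M := by
  rw [Finset.mul_sum, ← Finset.sum_sub_distrib]
  refine (Finset.abs_sum_le_sum_abs _ _).trans ?_
  refine (Finset.sum_le_card_nsmul _ _ M fun j _ => ?_).trans (by simp)
  rw [← mul_assoc, ← sub_mul, abs_mul]
  calc _ ≤ 1 * |(u j : ℝ)| := by gcongr; exact abs_trunc_sub_le N (x j)
    _ ≤ M := by rw [one_mul]; exact hu j

theorem abs_sum_trunc_mul_le (N : ℕ) (x : Fin p → ℝ) (u : Fin p → ℤ) (M B : ℝ) (hM : 0 ≤ M)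
    (hu : ∀ j, |(u j : ℝ)| ≤ M) (hx : ∑ j, |x j| ≤ B) :
    |∑ j, (trunc N (x j) : ℝ) * u j| ≤ 2 ^ N * B * M := by
  refine (Finset.abs_sum_le_sum_abs _ _).trans ?_
  calc _ ≤ ∑ j, 2 ^ N * |x j| * M := by
        refine Finset.sum_le_sum fun j _ => ?_
        rw [abs_mul]
        exact mul_le_mul (abs_trunc_le N (x j)) (hu j) (abs_nonneg _) (by positivity)
    _ = 2 ^ N * (∑ j, |x j|) * M := by rw [Finset.mul_sum, Finset.sum_mul]
    _ ≤ _ := by gcongr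

/-- The bound on the entries of the short vector found by the LBR algorithm. -/
def shortBound (n p G : ℕ) : ℕ := 15 * 2 ^ (n + p) * G * p ^ 3

set_option maxHeartbeats 1000000 in
-- The hypotheses on `X`, `W` and `Z` are the events later shown to be likely. In `hrel` the failing
-- row `i` must work for every `y` at once, because `y` is produced by the algorithm and may differ
-- between rows.
theorem run_eq (hn : 0 < n) (hnp : n ≤ p) (N Q Rh : ℕ) (hQ : 0 < Q) (hRh : 0 < Rh)
    (X : Fin n → Fin p → ℝ) (W : Fin n → ℝ) (b Z : Fin p → ℤ)
    (hb : ∀ j, |b j| ≤ (Q * Rh : ℕ))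
    (hZ : ∀ j, ((Q * Rh : ℕ) : ℤ) + 1 ≤ Z j ∧ Z j ≤ 2 * ((Q * Rh : ℕ) : ℤ) + Nat.log 2 p)
    (hgcd : Finset.univ.gcd (fun j => b j + Z j) = 1)
    (hN : 2 * p ^ 2 * shortBound n p (Q * Rh) < 2 ^ N)
    (hW : ∀ i, 2 ^ N * |W i| ≤ p) (hX : ∀ i, ∑ j, |X i j| ≤ (p : ℝ) ^ 3)
    (hlarge : ∀ i, 1 / (p : ℝ) ^ 2 < |∑ j, X i j * ((b j + Z j : ℤ) : ℝ)|)
    (hrel : ∀ v : Fin p → ℤ, (∀ j, |v j| ≤ shortBound n p (Q * Rh)) →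
      (∀ l : ℤ, ∃ j, v j ≠ l * (b j + Z j)) →
      ∃ i, ∀ y : ℤ, |y| ≤ (4 * shortBound n p (Q * Rh) * p ^ 5 : ℕ) →
        ((74 * shortBound n p (Q * Rh) * (Q * Rh) * p ^ 7 : ℕ) : ℝ) <
          2 ^ N * |∑ j, X i j * ((v j - y * (b j + Z j) : ℤ) : ℝ)|) :
    run (fun i => ∑ j, X i j * ((b j : ℝ) / Q) + W i) X N Q Rh 1 Z =
      fun j => (b j : ℝ) / Q := by
  have hp : 0 < p := hn.trans_le hnp
  obtain ⟨G, hG⟩ : ∃ G, G = Q * Rh := ⟨_, rfl⟩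
  rw [← hG] at hb hZ hN hrel
  obtain ⟨A, hA⟩ : ∃ A, A = shortBound n p G := ⟨_, rfl⟩
  rw [← hA] at hN hrel
  obtain ⟨s, hs⟩ : ∃ s : ℝ, s = 2 ^ N := ⟨_, rfl⟩
  rw [← hs] at hW hrel
  have hs1 : 1 ≤ s := hs ▸ one_le_pow₀ (by norm_num)
  have hs0 : 0 < s := by linarith
  have hP1 : (1 : ℝ) ≤ p := by exact_mod_cast hp
  have hG1 : (1 : ℝ) ≤ G := by rw [hG]; exact_mod_cast Nat.mul_pos hQ hRh
  have hQG : (Q : ℝ) ≤ G := by rw [hG]; exact_mod_cast Nat.le_mul_of_pos_right Q hRh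
  have hQ0 : (0 : ℝ) < Q := by exact_mod_cast hQ
  have hsA : 2 * (p : ℝ) ^ 2 * A < s := by rw [hs]; exact_mod_cast hN
  have hpow : (1 : ℝ) ≤ 2 ^ (n + p) := one_le_pow₀ (by norm_num)
  have hA' : (A : ℝ) = 15 * 2 ^ (n + p) * G * p ^ 3 := by
    rw [hA, shortBound]; push_cast; ring
  have hAG : 15 * (G : ℝ) * p ^ 3 ≤ A := by
    rw [hA']
    have : (0 : ℝ) ≤ 15 * G * p ^ 3 := by positivity
    nlinarith
  have hA0 : (0 : ℝ) < A := lt_of_lt_of_le (by positivity) hAG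
  have hlog : ((Nat.log 2 p : ℕ) : ℝ) ≤ p := by exact_mod_cast Nat.log_le_self 2 p
  have hZ' : ∀ j, (G : ℝ) + 1 ≤ Z j ∧ (Z j : ℝ) ≤ 2 * G + p := fun j => by
    have h1 : ((G : ℤ) : ℝ) + 1 ≤ Z j := by exact_mod_cast (hZ j).1
    have h2 : (Z j : ℝ) ≤ 2 * ((G : ℤ) : ℝ) + (Nat.log 2 p : ℕ) := by exact_mod_cast (hZ j).2
    push_cast at h1 h2
    exact ⟨h1, by linarith⟩
  have hb' : ∀ j, |(b j : ℝ)| ≤ G := fun j => by exact_mod_cast hb j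
  have hpos : ∀ j, 0 < b j + Z j := fun j => by
    have := abs_le.1 (hb j)
    have := (hZ j).1
    omega
  have hβ : ∀ j, |((b j + Z j : ℤ) : ℝ)| ≤ 4 * G * p := fun j => by
    have h1 := abs_le.1 (hb' j)
    have h2 := hZ' j
    push_cast
    rw [abs_le]
    constructor <;> nlinarith
  -- the translated observations
  set Yi : Fin n → ℤ := fun i => (Q : ℤ) * trunc N (∑ j, X i j * ((b j : ℝ) / Q) + W i) with hYi
  set Xi : Fin n → Fin p → ℤ := fun i j => trunc N (X i j) with hXi
  set t : Fin n → ℝ := fun i => ∑ j, X i j * ((b j + Z j : ℤ) : ℝ) with ht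
  -- Three errors add up: truncation of the observation (`Q`), truncation of `X` against `Z` (`p (2
  -- G + p)`), and the noise (`Q p`).
  have hY1 : ∀ i, |((Yi i + ∑ j, Xi i j * Z j : ℤ) : ℝ) - s * t i| ≤ 5 * G * p ^ 2 := by
    intro i
    have e1 := abs_trunc_sub_le N (∑ j, X i j * ((b j : ℝ) / Q) + W i)
    have e2 := abs_sum_trunc_sub_le N (X i) Z (2 * G + p) (fun j => by
      have := hZ' j
      rw [abs_le]
      constructor <;> linarith)
    have e3 := hW i
    rw [← hs] at e1 e2
    have hsum : ∑ j, X i j * ((b j : ℝ) / Q) = (∑ j, X i j * b j) / Q := by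
      rw [Finset.sum_div]
      exact Finset.sum_congr rfl fun j _ => by ring
    have hq : (Q : ℝ) * ∑ j, X i j * ((b j : ℝ) / Q) = ∑ j, X i j * b j := by
      rw [hsum]
      field_simp
    have htt : t i = ∑ j, X i j * b j + ∑ j, X i j * Z j := by
      rw [← Finset.sum_add_distrib]
      exact Finset.sum_congr rfl fun j _ => by push_cast; ring
    have hdec : ((Yi i + ∑ j, Xi i j * Z j : ℤ) : ℝ) - s * t i =
        Q * ((trunc N (∑ j, X i j * ((b j : ℝ) / Q) + W i) : ℝ)
          - s * (∑ j, X i j * ((b j : ℝ) / Q) + W i)) +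
        (∑ j, (trunc N (X i j) : ℝ) * Z j - s * ∑ j, X i j * Z j) + Q * (s * W i) := by
      rw [htt, hYi, hXi]
      push_cast
      linear_combination s * hq
    rw [hdec]
    have e4 : |s * W i| ≤ p := by rwa [abs_mul, abs_of_pos hs0]
    calc _ ≤ (Q * 1 + p * (2 * G + p) + Q * p : ℝ) := by
          refine (abs_add_le _ _).trans (add_le_add ((abs_add_le _ _).trans (add_le_add ?_ e2)) ?_)
          · rw [abs_mul, abs_of_pos hQ0]
            gcongr
          · rw [abs_mul, abs_of_pos hQ0]
            gcongr
      _ ≤ (G * 1 + p * (2 * G + p) + G * p : ℝ) := by gcongr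
      _ ≤ 5 * G * p ^ 2 := by
          have h1 : (G : ℝ) ≤ G * p ^ 2 := le_mul_of_one_le_right (by linarith) (one_le_pow₀ hP1)
          have h2 : (G : ℝ) * p ≤ G * p ^ 2 := by
            gcongr
            exact le_self_pow₀ hP1 (by norm_num)
          have h3 : (p : ℝ) ^ 2 ≤ G * p ^ 2 := le_mul_of_one_le_left (by positivity) hG1
          nlinarith
  set Y₂ := ELO.modified Yi Xi Z with hY₂
  set w₂ : Fin n → ℤ := fun i => Y₂ i - ∑ j, Xi i j * (b j + Z j) with hw₂
  have hw₂le : ∀ i, |(w₂ i : ℝ)| ≤ 14 * G * p ^ 2 := by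
    intro i
    have e1 := hY1 i
    have e2 : |(Y₂ i : ℝ) - ((Yi i + ∑ j, Xi i j * Z j : ℤ) : ℝ)| ≤ 5 := by
      exact_mod_cast ELO.abs_modified_sub_le Yi Xi Z i
    have e3 := abs_sum_trunc_sub_le N (X i) (fun j => b j + Z j) (3 * G + p) (fun j => by
      have h1 := abs_le.1 (hb' j)
      have h2 := hZ' j
      push_cast
      rw [abs_le]
      constructor <;> linarith)
    rw [← hs] at e3
    have hdec : (w₂ i : ℝ) = ((Y₂ i : ℝ) - ((Yi i + ∑ j, Xi i j * Z j : ℤ) : ℝ)) +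
        (((Yi i + ∑ j, Xi i j * Z j : ℤ) : ℝ) - s * t i) -
        (∑ j, (trunc N (X i j) : ℝ) * ((b j + Z j : ℤ) : ℝ) -
          s * ∑ j, X i j * ((b j + Z j : ℤ) : ℝ)) := by
      rw [hw₂, hXi, ht]
      push_cast
      ring
    rw [hdec]
    calc _ ≤ (5 + 5 * G * p ^ 2 + p * (3 * G + p) : ℝ) :=
          (abs_sub _ _).trans (add_le_add ((abs_add_le _ _).trans (add_le_add e2 e1)) e3)
      _ ≤ 14 * G * p ^ 2 := by
          have h1 : (1 : ℝ) ≤ G * p ^ 2 := one_le_mul_of_one_le_of_one_le hG1 (one_le_pow₀ hP1)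
          have h2 : (G : ℝ) * p ≤ G * p ^ 2 := by
            gcongr
            exact le_self_pow₀ hP1 (by norm_num)
          have h3 : (p : ℝ) ^ 2 ≤ G * p ^ 2 := le_mul_of_one_le_left (by positivity) hG1
          nlinarith
  -- The main term `s |t i|` exceeds `s / p²`; the error `5 G p²` is below `A`, which is less than
  -- half of that.
  have hY₂large : ∀ i, s / (2 * p ^ 2) ≤ |(Y₂ i : ℝ)| := by
    intro i
    have e1 : |((Yi i + ∑ j, Xi i j * Z j : ℤ) : ℝ)| ≤ |(Y₂ i : ℝ)| := by
      exact_mod_cast ELO.abs_le_abs_modified Yi Xi Z i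
    have e2 := hY1 i
    have e3 : s * (1 / (p : ℝ) ^ 2) ≤ |s * t i| := by
      rw [abs_mul, abs_of_pos hs0]
      gcongr
      exact (hlarge i).le
    have e4 : |s * t i| - |((Yi i + ∑ j, Xi i j * Z j : ℤ) : ℝ)| ≤ 5 * G * p ^ 2 := by
      refine (abs_sub_abs_le_abs_sub _ _).trans ?_
      rwa [abs_sub_comm]
    have e5 : (A : ℝ) < s / (2 * p ^ 2) := by
      rw [lt_div_iff₀ (by positivity)]
      linarith
    have e6 : 5 * (G : ℝ) * p ^ 2 ≤ A := by
      refine le_trans ?_ hAG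
      have : (p : ℝ) ^ 2 ≤ p ^ 3 := pow_le_pow_right₀ hP1 (by norm_num)
      have : (G : ℝ) * p ^ 2 ≤ G * p ^ 3 := by gcongr
      nlinarith [mul_nonneg (Nat.cast_nonneg (α := ℝ) G) (sq_nonneg (p : ℝ))]
    have e7 : s * (1 / (p : ℝ) ^ 2) = 2 * (s / (2 * p ^ 2)) := by
      field_simp
    linarith
  have helo : ELO.run Yi Xi G (2 * Q * (2 ^ N * 1 + Rh * p)) Z = fun j => (b j : ℝ) := by
    refine ELO.run_eq hp Yi Xi G _ Z b A ?_ hpos hgcd ?_ ?_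
    · have h1 : A < 2 ^ N := lt_of_le_of_lt (Nat.le_mul_of_pos_left A (by positivity)) hN
      refine h1.trans_le ?_
      unfold ELO.multiplier
      have h2 : 1 ≤ ⌈Real.sqrt n⌉₊ := Nat.one_le_ceil_iff.2 (Real.sqrt_pos.2 (by exact_mod_cast hn))
      calc 2 ^ N ≤ 2 * Q * (2 ^ N * 1 + Rh * p) := by
            nlinarith [Nat.zero_le (Rh * p), Nat.one_le_two_pow (n := N)]
        _ ≤ 2 * Q * (2 ^ N * 1 + Rh * p) * ⌈Real.sqrt n⌉₊ := Nat.le_mul_of_pos_right _ h2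
        _ ≤ G * ⌈Real.sqrt p⌉₊ + 2 * Q * (2 ^ N * 1 + Rh * p) * ⌈Real.sqrt n⌉₊ :=
            Nat.le_add_left _ _
        _ ≤ _ := Nat.le_mul_of_pos_left _ (by positivity)
    · have h1 : ∑ j, ((b j + Z j : ℤ) : ℝ) ^ 2 ≤ p * (4 * G * p) ^ 2 := by
        refine (Finset.sum_le_card_nsmul _ _ ((4 * G * p) ^ 2 : ℝ) fun j _ => ?_).trans (by simp)
        rw [← sq_abs]
        gcongr
        exact hβ j
      have h2 : ∑ i, ((w₂ i : ℤ) : ℝ) ^ 2 ≤ p * (14 * G * p ^ 2) ^ 2 := by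
        refine (Finset.sum_le_card_nsmul _ _ ((14 * G * p ^ 2) ^ 2 : ℝ) fun i _ => ?_).trans ?_
        · rw [← sq_abs]
          gcongr
          exact hw₂le i
        · simp only [Finset.card_univ, Fintype.card_fin, nsmul_eq_mul]
          gcongr
      -- The LLL factor is the square of at most `2 ^ (n + p)`; this and `16 + 196 ≤ 15²` explain
      -- the form of `shortBound`.
      have h3 : (2 : ℝ) ^ (p + n + n) ≤ (2 ^ (n + p)) ^ 2 := by
        rw [← pow_mul]
        exact pow_le_pow_right₀ (by norm_num) (by omega)
      calc _ ≤ (2 ^ (n + p)) ^ 2 * (p * (4 * G * p) ^ 2 + p * (14 * G * p ^ 2) ^ 2 : ℝ) :=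
            mul_le_mul h3 (add_le_add h1 h2) (by positivity) (by positivity)
        _ ≤ (2 ^ (n + p)) ^ 2 * ((15 * G * p ^ 3) ^ 2 : ℝ) := by
            gcongr
            have h4 : (G : ℝ) ^ 2 * p ^ 3 ≤ G ^ 2 * p ^ 6 := by
              gcongr
              · norm_num
            have h5 : (G : ℝ) ^ 2 * p ^ 5 ≤ G ^ 2 * p ^ 6 := by
              gcongr
              · norm_num
            have h6 : (0 : ℝ) ≤ G ^ 2 * p ^ 6 := by positivity
            calc (p * (4 * G * p) ^ 2 + p * (14 * G * p ^ 2) ^ 2 : ℝ)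
                = 16 * (G ^ 2 * p ^ 3) + 196 * (G ^ 2 * p ^ 5) := by ring
              _ ≤ 225 * (G ^ 2 * p ^ 6) := by linarith
              _ = (15 * G * p ^ 3) ^ 2 := by ring
        _ = (A : ℝ) ^ 2 := by rw [hA']; ring
    · intro v y w hv hw heq hne
      have hv' : ∀ j, |(v j : ℝ)| ≤ A := fun j => by exact_mod_cast hv j
      have hw' : ∀ i, |(w i : ℝ)| ≤ A := fun i => by exact_mod_cast hw i
      have heq' : ∀ i, (Y₂ i : ℝ) * y i = ∑ j, (trunc N (X i j) : ℝ) * v j + w i := by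
        intro i
        have : Y₂ i * y i = ∑ j, Xi i j * v j + w i := by linarith [heq i]
        exact_mod_cast this
      -- The relation bounds the product `Y₂ y` by `2 A s p³`, and `Y₂` is large.
      have hy : ∀ i, |(y i : ℝ)| ≤ 4 * A * p ^ 5 := by
        intro i
        have e1 : |(Y₂ i : ℝ)| * |(y i : ℝ)| ≤ 2 * A * s * p ^ 3 := by
          rw [← abs_mul, heq' i]
          refine (abs_add_le _ _).trans ?_
          have e2 := abs_sum_trunc_mul_le N (X i) v A (p ^ 3) hA0.le hv' (hX i)
          rw [← hs] at e2
          have e3 := hw' i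
          have e4 : (1 : ℝ) ≤ s * p ^ 3 :=
            one_le_mul_of_one_le_of_one_le hs1 (one_le_pow₀ hP1)
          have e5 : (A : ℝ) ≤ A * (s * p ^ 3) := le_mul_of_one_le_right hA0.le e4
          calc _ ≤ (s * p ^ 3 * A + A * (s * p ^ 3) : ℝ) := add_le_add e2 (e3.trans e5)
            _ = _ := by ring
        have e2 : s / (2 * p ^ 2) * |(y i : ℝ)| ≤ 2 * A * s * p ^ 3 :=
          (mul_le_mul_of_nonneg_right (hY₂large i) (abs_nonneg _)).trans e1
        rw [div_mul_eq_mul_div, div_le_iff₀ (by positivity)] at e2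
        have e3 : s * |(y i : ℝ)| ≤ s * (4 * A * p ^ 5) := by
          refine e2.trans (le_of_eq ?_)
          ring
        exact le_of_mul_le_mul_left e3 hs0
      -- If `v` is a multiple, it remains to exclude `l = 0`: then `Y₂ y = w` with some `w i ≠ 0`,
      -- so `|Y₂ i| ≤ A`, against the lower bound on `Y₂`.
      by_cases hl : ∃ l : ℤ, ∀ j, v j = l * (b j + Z j)
      · obtain ⟨l, hl⟩ := hl
        refine ⟨l, ?_, hl⟩
        rintro rfl
        have hv0 : v = 0 := funext fun j => by rw [hl j, zero_mul]; rfl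
        have hw0 : w ≠ 0 := hne.resolve_left (not_not.2 hv0)
        obtain ⟨i, hi⟩ := Function.ne_iff.1 hw0
        have e1 := heq' i
        simp only [hv0, Pi.zero_apply, Int.cast_zero, mul_zero, Finset.sum_const_zero,
          zero_add] at e1
        have hy0 : y i ≠ 0 := fun h => hi (by
          rw [h] at e1
          simp at e1
          exact_mod_cast e1.symm)
        have e2 : (1 : ℝ) ≤ |(y i : ℝ)| := by exact_mod_cast Int.one_le_abs hy0
        have e3 : |(Y₂ i : ℝ)| ≤ A := by
          refine le_trans ?_ (hw' i)
          rw [← e1, abs_mul]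
          exact le_mul_of_one_le_right (abs_nonneg _) e2
        have e4 : (A : ℝ) < s / (2 * p ^ 2) := by
          rw [lt_div_iff₀ (by positivity)]
          linarith
        exact absurd (hY₂large i) (not_le.2 (e3.trans_lt e4))
      · push Not at hl
        obtain ⟨i, hi⟩ := hrel v hv hl
        have hlt := hi (y i) (by
          have := hy i
          exact_mod_cast this)
        exfalso
        set u : Fin p → ℤ := fun j => v j - y i * (b j + Z j) with hu
        have hule : ∀ j, |(u j : ℝ)| ≤ A + 4 * A * p ^ 5 * (4 * G * p) := by
          intro j
          have : (u j : ℝ) = v j - y i * ((b j + Z j : ℤ) : ℝ) := by rw [hu]; push_cast; ring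
          rw [this]
          refine (abs_sub _ _).trans (add_le_add (hv' j) ?_)
          rw [abs_mul]
          exact mul_le_mul (hy i) (hβ j) (abs_nonneg _) (by positivity)
        have e1 := abs_sum_trunc_sub_le N (X i) u _ hule
        rw [← hs] at e1
        -- Subtracting `y` times the relation satisfied by `b + Z` eliminates the large number `Y₂
        -- i`; only the small residuals remain.
        have e2 : ∑ j, (trunc N (X i j) : ℝ) * u j = y i * w₂ i - w i := by
          have h1 : ∑ j, Xi i j * u j = y i * w₂ i - w i := by
            have : ∑ j, Xi i j * u j = ∑ j, Xi i j * v j - y i * ∑ j, Xi i j * (b j + Z j) := by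
              rw [Finset.mul_sum, ← Finset.sum_sub_distrib]
              exact Finset.sum_congr rfl fun j _ => by rw [hu]; ring
            rw [this, hw₂]
            linarith [heq i]
          exact_mod_cast h1
        have e3 : |(y i : ℝ) * w₂ i - w i| ≤ 4 * A * p ^ 5 * (14 * G * p ^ 2) + A := by
          refine (abs_sub _ _).trans (add_le_add ?_ (hw' i))
          rw [abs_mul]
          exact mul_le_mul (hy i) (hw₂le i) (abs_nonneg _) (by positivity)
        have e4 : s * |∑ j, X i j * (u j : ℝ)| ≤ 4 * A * p ^ 5 * (14 * G * p ^ 2) + A +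
            p * (A + 4 * A * p ^ 5 * (4 * G * p)) := by
          rw [← abs_of_pos hs0, ← abs_mul]
          rw [e2] at e1
          have h1 := abs_sub_abs_le_abs_sub (s * ∑ j, X i j * (u j : ℝ)) (y i * w₂ i - w i)
          rw [abs_sub_comm (s * ∑ j, X i j * (u j : ℝ)) (y i * w₂ i - w i)] at h1
          linarith
        have e5 : 4 * (A : ℝ) * p ^ 5 * (14 * G * p ^ 2) + A +
            p * (A + 4 * A * p ^ 5 * (4 * G * p)) ≤ 74 * A * G * p ^ 7 := by
          have h1 : (1 : ℝ) ≤ G * p ^ 7 := one_le_mul_of_one_le_of_one_le hG1 (one_le_pow₀ hP1)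
          have h2 : (A : ℝ) ≤ A * (G * p ^ 7) := le_mul_of_one_le_right hA0.le h1
          have h3 : (p : ℝ) ≤ G * p ^ 7 :=
            (le_self_pow₀ hP1 (by norm_num)).trans (le_mul_of_one_le_left (by positivity) hG1)
          have h4 : (A : ℝ) * p ≤ A * (G * p ^ 7) := by gcongr
          nlinarith
        have e6 : ((74 * A * G * p ^ 7 : ℕ) : ℝ) = 74 * A * G * p ^ 7 := by push_cast; ring
        rw [e6] at hlt
        linarith
  funext j
  change ELO.run Yi Xi (Q * Rh) (2 * Q * (2 ^ N * 1 + Rh * p)) Z j / (Q : ℝ) = b j / Q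
  rw [← hG, helo]

end LBR

/-! ### Small-ball, tail and union bounds -/

theorem HasDensityBoundedBy.apply_le {D : Measure ℝ} {c : ℝ} (hD : HasDensityBoundedBy D c)
    {S : Set ℝ} (hS : MeasurableSet S) : D S ≤ ENNReal.ofReal c * volume S := by
  obtain ⟨f, -, rfl, hle⟩ := hD
  rw [withDensity_apply _ hS]
  calc _ ≤ ∫⁻ _ in S, ENNReal.ofReal c :=
        lintegral_mono_ae (ae_restrict_of_ae hle)
    _ = _ := by simp

theorem HasDensityBoundedBy.affine_le {D : Measure ℝ} {c : ℝ} (hc : 0 ≤ c)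
    (hD : HasDensityBoundedBy D c) {a : ℝ} (ha : 1 ≤ |a|) (r h : ℝ) :
    D {x | |x * a + r| ≤ h} ≤ ENNReal.ofReal (2 * c * h) := by
  have ha0 : a ≠ 0 := fun h0 => by simp [h0] at ha; linarith
  have hsub : {x | |x * a + r| ≤ h} ⊆ Metric.closedBall (-(r / a)) h := by
    intro x hx
    rw [Metric.mem_closedBall, Real.dist_eq, sub_neg_eq_add]
    have h1 : x * a + r = (x + r / a) * a := by field_simp
    rw [Set.mem_ofPred_eq, h1, abs_mul] at hx
    exact (le_mul_of_one_le_right (abs_nonneg _) ha).trans hx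
  calc _ ≤ D (Metric.closedBall (-(r / a)) h) := measure_mono hsub
    _ ≤ ENNReal.ofReal c * volume (Metric.closedBall (-(r / a)) h) :=
        hD.apply_le Metric.isClosed_closedBall.measurableSet
    _ = _ := by
        rw [Real.volume_closedBall, ← ENNReal.ofReal_mul hc]
        congr 1
        ring

/-- Freeze all coordinates except `j₀`. The remaining coordinate must lie in an interval of length
at most `2 h`, whatever the frozen values are. -/
theorem HasDensityBoundedBy.pi_le {D : Measure ℝ} [IsProbabilityMeasure D] {c : ℝ} (hc : 0 ≤ c)
    (hD : HasDensityBoundedBy D c) {p : ℕ} (u : Fin p → ℝ) {j₀ : Fin p} (hu : 1 ≤ |u j₀|)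
    (h : ℝ) :
    (Measure.pi fun _ : Fin p => D) {x | |∑ j, x j * u j| ≤ h} ≤ ENNReal.ofReal (2 * c * h) := by
  obtain _ | k := p
  · exact j₀.elim0
  have hmp := measurePreserving_piFinSuccAbove (fun _ : Fin (k + 1) => D) j₀
  set S : Set (ℝ × (Fin k → ℝ)) :=
    {y | |y.1 * u j₀ + ∑ j, y.2 j * u (j₀.succAbove j)| ≤ h} with hS
  have hSm : MeasurableSet S := by
    refine measurableSet_le ?_ measurable_const
    fun_prop
  have hpre : {x : Fin (k + 1) → ℝ | |∑ j, x j * u j| ≤ h} =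
      MeasurableEquiv.piFinSuccAbove (fun _ : Fin (k + 1) => ℝ) j₀ ⁻¹' S := by
    ext x
    rw [Set.mem_preimage, hS, Set.mem_ofPred_eq, Set.mem_ofPred_eq, Fin.sum_univ_succAbove _ j₀]
    rfl
  rw [hpre, hmp.measure_preimage hSm.nullMeasurableSet, Measure.prod_apply_symm hSm]
  have key : ∀ y : Fin k → ℝ, D ((fun x => (x, y)) ⁻¹' S) ≤ ENNReal.ofReal (2 * c * h) := fun y =>
    hD.affine_le hc hu (∑ j, y j * u (j₀.succAbove j)) h
  refine (lintegral_mono key).trans (le_of_eq ?_)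
  rw [lintegral_const, measure_univ, mul_one]

theorem pi_exists_le {n : ℕ} {α : Type*} [MeasurableSpace α] (μ : Measure α)
    [IsProbabilityMeasure μ] {S : Set α} (hS : MeasurableSet S) :
    (Measure.pi fun _ : Fin n => μ) {x | ∃ i, x i ∈ S} ≤ n * μ S := by
  have : {x : Fin n → α | ∃ i, x i ∈ S} = ⋃ i, Function.eval i ⁻¹' S := by
    ext x; simp
  rw [this]
  refine (measure_iUnion_fintype_le _ _).trans (le_of_eq ?_)
  have h : ∀ i : Fin n, (Measure.pi fun _ : Fin n => μ) (Function.eval i ⁻¹' S) = μ S := fun i =>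
    (measurePreserving_eval (fun _ : Fin n => μ) i).measure_preimage hS.nullMeasurableSet
  simp [h]

theorem pi_sum_abs_ge_le (D : Measure ℝ) [IsProbabilityMeasure D]
    (hmoment : Integrable (fun v : ℝ => v) D) (p : ℕ) {B : ℝ} (hB : 0 < B) :
    (Measure.pi fun _ : Fin p => D) {x | B ≤ ∑ j, |x j|} ≤
      ENNReal.ofReal (p * (∫ x, |x| ∂D) / B) := by
  have hsub : {x : Fin p → ℝ | B ≤ ∑ j, |x j|} = {x | ENNReal.ofReal B ≤ ∑ j, ‖x j‖ₑ} := by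
    ext x
    have : ∑ j, ‖x j‖ₑ = ENNReal.ofReal (∑ j, |x j|) := by
      rw [ENNReal.ofReal_sum_of_nonneg fun j _ => abs_nonneg _]
      exact Finset.sum_congr rfl fun j _ => Real.enorm_eq_ofReal_abs _
    rw [Set.mem_ofPred_eq, Set.mem_ofPred_eq, this,
      ENNReal.ofReal_le_ofReal_iff (Finset.sum_nonneg fun j _ => abs_nonneg _)]
  have hint : ∫⁻ x : Fin p → ℝ, ∑ j, ‖x j‖ₑ ∂(Measure.pi fun _ => D) =
      ENNReal.ofReal (p * ∫ x, |x| ∂D) := by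
    rw [lintegral_finsetSum _ fun j _ => (measurable_pi_apply j).enorm]
    have h : ∀ j : Fin p, ∫⁻ x : Fin p → ℝ, ‖x j‖ₑ ∂(Measure.pi fun _ => D) =
        ENNReal.ofReal (∫ x, |x| ∂D) := fun j => by
      rw [(measurePreserving_eval (fun _ : Fin p => D) j).lintegral_comp
        (f := fun x : ℝ => ‖x‖ₑ) measurable_enorm]
      exact (ofReal_integral_norm_eq_lintegral_enorm hmoment).symm
    rw [Finset.sum_congr rfl fun j _ => h j, ENNReal.ofReal_mul (Nat.cast_nonneg p)]
    simp
  rw [hsub]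
  refine (meas_ge_le_lintegral_div ?_ (by simpa using hB) ENNReal.ofReal_ne_top).trans ?_
  · exact (Finset.measurable_sum _ fun j _ => (measurable_pi_apply j).enorm).aemeasurable
  · rw [hint, ENNReal.ofReal_div_of_pos hB]

theorem gaussianReal_abs_ge_le (σ : ℝ) {B : ℝ} (hB : 0 < B) :
    gaussianReal 0 (Real.toNNReal (σ ^ 2)) {w | B ≤ |w|} ≤ ENNReal.ofReal (σ ^ 2 / B ^ 2) := by
  have h := meas_ge_le_variance_div_sq
    (memLp_id_gaussianReal' (μ := 0) (v := Real.toNNReal (σ ^ 2)) 2 (by simp)) hB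
  rw [variance_id_gaussianReal, Real.coe_toNNReal _ (sq_nonneg σ)] at h
  simpa [integral_id_gaussianReal] using h

/-- The union bound over integer relations that are not multiples of `β`. -/
theorem pi_exists_relation_le {D : Measure ℝ} [IsProbabilityMeasure D] {c : ℝ} (hc : 0 ≤ c)
    (hD : HasDensityBoundedBy D c) {n p : ℕ} (β : Fin p → ℤ) (A M : ℕ) {h : ℝ} (hh : 0 ≤ h) :
    (Measure.pi fun _ : Fin n => Measure.pi fun _ : Fin p => D)
      {X | ∃ v : Fin p → ℤ, (∀ j, |v j| ≤ A) ∧ (∀ l : ℤ, ∃ j, v j ≠ l * β j) ∧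
        ∀ i, ∃ y : ℤ, |y| ≤ M ∧ |∑ j, X i j * ((v j - y * β j : ℤ) : ℝ)| ≤ h} ≤
      ENNReal.ofReal ((2 * A + 1) ^ p * ((2 * M + 1) * (2 * c * h)) ^ n) := by
  classical
  set V : Finset (Fin p → ℤ) := Fintype.piFinset fun _ => Finset.Icc (-(A : ℤ)) A with hV
  -- The union over `y` is taken inside each row, so `E v` is an event about a single row and
  -- independence yields its `n`-th power.
  set E : (Fin p → ℤ) → Set (Fin p → ℝ) := fun v =>
    ⋃ y ∈ Finset.Icc (-(M : ℤ)) M, {x | |∑ j, x j * ((v j - y * β j : ℤ) : ℝ)| ≤ h} with hE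
  have hEle : ∀ v : Fin p → ℤ, (∀ l : ℤ, ∃ j, v j ≠ l * β j) →
      (Measure.pi fun _ : Fin p => D) (E v) ≤
        ENNReal.ofReal ((2 * M + 1) * (2 * c * h)) := by
    intro v hv
    refine (measure_biUnion_finset_le _ _).trans ?_
    calc _ ≤ ∑ _y ∈ Finset.Icc (-(M : ℤ)) M, ENNReal.ofReal (2 * c * h) := by
          refine Finset.sum_le_sum fun y _ => ?_
          -- Since `v` is not `y β`, the integer vector `v - y β` has an entry of absolute value at
          -- least `1`.
          obtain ⟨j₀, hj₀⟩ := hv y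
          refine hD.pi_le hc (fun j => ((v j - y * β j : ℤ) : ℝ)) (j₀ := j₀) ?_ h
          exact_mod_cast Int.one_le_abs (sub_ne_zero.2 hj₀)
      _ = _ := by
          rw [Finset.sum_const, Int.card_Icc, nsmul_eq_mul,
            ENNReal.ofReal_mul (by positivity : (0 : ℝ) ≤ 2 * M + 1)]
          congr 1
          rw [show (M + 1 - -(M : ℤ)).toNat = 2 * M + 1 by omega,
            show (2 * (M : ℝ) + 1) = ((2 * M + 1 : ℕ) : ℝ) by push_cast; ring,
            ENNReal.ofReal_natCast]
  have hsub : {X : Fin n → Fin p → ℝ | ∃ v : Fin p → ℤ, (∀ j, |v j| ≤ A) ∧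
      (∀ l : ℤ, ∃ j, v j ≠ l * β j) ∧
        ∀ i, ∃ y : ℤ, |y| ≤ M ∧ |∑ j, X i j * ((v j - y * β j : ℤ) : ℝ)| ≤ h} ⊆
      ⋃ v ∈ V.filter (fun v => ∀ l : ℤ, ∃ j, v j ≠ l * β j),
        Set.univ.pi fun _ : Fin n => E v := by
    rintro X ⟨v, hv1, hv2, hv3⟩
    rw [Set.mem_iUnion₂]
    refine ⟨v, ?_, ?_⟩
    · rw [Finset.mem_filter, hV, Fintype.mem_piFinset]
      exact ⟨fun j => Finset.mem_Icc.2 (abs_le.1 (hv1 j)), hv2⟩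
    · intro i _
      obtain ⟨y, hy1, hy2⟩ := hv3 i
      rw [hE]
      simp only [Set.mem_iUnion]
      exact ⟨y, Finset.mem_Icc.2 (abs_le.1 hy1), hy2⟩
  refine (measure_mono hsub).trans ((measure_biUnion_finset_le _ _).trans ?_)
  have hpow : ENNReal.ofReal ((2 * M + 1) * (2 * c * h)) ^ n =
      ENNReal.ofReal (((2 * M + 1) * (2 * c * h)) ^ n) := by
    rw [ENNReal.ofReal_pow (by positivity)]
  calc _ ≤ ∑ _v ∈ V.filter (fun v => ∀ l : ℤ, ∃ j, v j ≠ l * β j),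
        ENNReal.ofReal (((2 * M + 1) * (2 * c * h)) ^ n) := by
        refine Finset.sum_le_sum fun v hv => ?_
        rw [Measure.pi_pi, Finset.prod_const, Finset.card_univ, Fintype.card_fin, ← hpow]
        exact pow_le_pow_left' (hEle v (Finset.mem_filter.1 hv).2) n
    _ ≤ ∑ _v ∈ V, ENNReal.ofReal (((2 * M + 1) * (2 * c * h)) ^ n) :=
        Finset.sum_le_sum_of_subset (Finset.filter_subset _ _)
    _ = _ := by
        rw [Finset.sum_const, hV, Fintype.card_piFinset_const, Int.card_Icc, nsmul_eq_mul,
          ENNReal.ofReal_mul (by positivity : (0 : ℝ) ≤ (2 * A + 1) ^ p)]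
        congr 1
        rw [show (A + 1 - -(A : ℤ)).toNat = 2 * A + 1 by omega,
          show (2 * (A : ℝ) + 1) ^ p = (((2 * A + 1) ^ p : ℕ) : ℝ) by push_cast; ring,
          ENNReal.ofReal_natCast]

/-! ### The random translation makes the entries coprime -/

/-- A residue class modulo `g` has at most `(b - a) / g + 1` members among `b - a` consecutive
integers. -/
theorem uniformOn_dvd_le {a b : ℤ} (hab : a < b) (t : ℤ) {g : ℕ} (hg : 0 < g) :
    uniformOn (Set.Icc (a + 1) b) {z | (g : ℤ) ∣ t + z} ≤
      ENNReal.ofReal (1 / g + 1 / (b - a : ℤ)) := by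
  classical
  have hI : Set.Icc (a + 1) b = (Finset.Ioc a b : Set ℤ) := by
    ext z
    simp
  have hfin : (Set.Icc (a + 1) b).Finite := Set.finite_Icc _ _
  have hset : Set.Icc (a + 1) b ∩ {z | (g : ℤ) ∣ t + z} =
      ((Finset.Ioc a b ∩ (Finset.Ioc a b).filter (fun z => z ≡ -t [ZMOD g]) : Finset ℤ) :
        Set ℤ) := by
    ext z
    have : (g : ℤ) ∣ t + z ↔ z ≡ -t [ZMOD g] := by
      rw [Int.modEq_comm, Int.modEq_iff_dvd, sub_neg_eq_add, add_comm]
    simp only [hI, Set.mem_inter_iff, Finset.mem_coe, Set.mem_ofPred_eq, Finset.coe_inter,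
      Finset.mem_filter, this]
    tauto
  have hcard := Int.Ioc_filter_modEq_card a b (r := (g : ℤ)) (by exact_mod_cast hg) (-t)
  have hcardR : (((Finset.Ioc a b).filter (fun z => z ≡ -t [ZMOD g])).card : ℝ) ≤
      (b - a : ℤ) / g + 1 := by
    have hg' : (0 : ℚ) < g := by exact_mod_cast hg
    have h1 : ((((Finset.Ioc a b).filter (fun z => z ≡ -t [ZMOD g])).card : ℤ) : ℚ) ≤
        (b - a : ℤ) / g + 1 := by
      rw [hcard]
      push_cast
      refine max_le ?_ ?_
      · have e1 := Int.floor_le ((b - -t : ℚ) / g)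
        have e2 := Int.lt_floor_add_one ((a - -t : ℚ) / g)
        have e3 : ((b : ℚ) - a) / g = (b - -t : ℚ) / g - (a - -t : ℚ) / g := by ring
        rw [e3]
        linarith
      · have : (0 : ℚ) ≤ b - a := by
          have : (a : ℚ) < b := by exact_mod_cast hab
          linarith
        positivity
    exact_mod_cast h1
  rw [← uniformOn_inter_self hfin, hset, hI, uniformOn_apply_finset, Finset.inter_eq_right.2
    (Finset.inter_subset_left), Finset.inter_eq_right.2 (Finset.filter_subset _ _)]
  have hL : 0 < b - a := by omega
  have hLR : (0 : ℝ) < ((b - a : ℤ) : ℝ) := by exact_mod_cast hL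
  have hcI : ((Finset.Ioc a b).card : ℝ≥0∞) = ENNReal.ofReal ((b - a : ℤ) : ℝ) := by
    rw [Int.card_Ioc, ← ENNReal.ofReal_natCast]
    congr 1
    exact_mod_cast Int.toNat_of_nonneg hL.le
  rw [hcI, ← ENNReal.ofReal_natCast, ← ENNReal.ofReal_div_of_pos hLR]
  refine ENNReal.ofReal_le_ofReal ?_
  rw [div_le_iff₀ hLR]
  refine hcardR.trans (le_of_eq ?_)
  field_simp

namespace ELO

theorem isProbabilityMeasure_translationLaw (p : ℕ) {G : ℕ} (hG : 0 < G) :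
    IsProbabilityMeasure (translationLaw p G) := by
  have : IsProbabilityMeasure (uniformOn (Set.Icc ((G : ℤ) + 1)
      (2 * (G : ℤ) + (Nat.log 2 p : ℤ)))) :=
    isProbabilityMeasure_uniformOn (Set.finite_Icc _ _) (Set.nonempty_Icc.2 (by omega))
  unfold translationLaw
  infer_instance

theorem translationLaw_box_compl (p : ℕ) {G : ℕ} (hG : 0 < G) :
    translationLaw p G {Z | ¬ ∀ j, (G : ℤ) + 1 ≤ Z j ∧ Z j ≤ 2 * (G : ℤ) + Nat.log 2 p} = 0 := by
  have : IsProbabilityMeasure (uniformOn (Set.Icc ((G : ℤ) + 1)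
      (2 * (G : ℤ) + (Nat.log 2 p : ℤ)))) :=
    isProbabilityMeasure_uniformOn (Set.finite_Icc _ _) (Set.nonempty_Icc.2 (by omega))
  have hset : {Z : Fin p → ℤ | ¬ ∀ j, (G : ℤ) + 1 ≤ Z j ∧ Z j ≤ 2 * (G : ℤ) + Nat.log 2 p} =
      {Z | ∃ j, Z j ∈ (Set.Icc ((G : ℤ) + 1) (2 * (G : ℤ) + (Nat.log 2 p : ℤ)))ᶜ} := by
    ext Z
    simp only [Set.mem_ofPred_eq, not_forall, Set.mem_compl_iff, Set.mem_Icc]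
  rw [hset]
  refine le_antisymm ((pi_exists_le _ (MeasurableSet.of_discrete)).trans (le_of_eq ?_)) zero_le
  rw [prob_compl_eq_zero_iff MeasurableSet.of_discrete |>.2, mul_zero]
  exact uniformOn_self (Set.finite_Icc _ _) (Set.nonempty_Icc.2 (by omega))

/-- Union bound over the possible common divisors `g ≥ 2`. Each entry is divisible by `g` with
probability at most `1 / g + 1 / L`, where `L` is the number of values of `Z_j`. The entries are
positive and at most `3 G + log p ≤ 3 L`, so no larger `g` occurs. -/
theorem translationLaw_gcd_ne_one_le {p : ℕ} (hp : 2 ≤ p) {G : ℕ} (hG : 6 ≤ G) (b : Fin p → ℤ)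
    (hb : ∀ j, |b j| ≤ G) :
    translationLaw p G {Z | (∀ j, (G : ℤ) + 1 ≤ Z j ∧ Z j ≤ 2 * (G : ℤ) + Nat.log 2 p) ∧
      Finset.univ.gcd (fun j => b j + Z j) ≠ 1} ≤ ENNReal.ofReal (16 * (2 / 3) ^ (p - 2)) := by
  have hprob : IsProbabilityMeasure (uniformOn (Set.Icc ((G : ℤ) + 1)
      (2 * (G : ℤ) + (Nat.log 2 p : ℤ)))) :=
    isProbabilityMeasure_uniformOn (Set.finite_Icc _ _) (Set.nonempty_Icc.2 (by omega))
  set L : ℕ := G + Nat.log 2 p with hL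
  set M : ℕ := 3 * G + Nat.log 2 p with hM
  have hsub : {Z : Fin p → ℤ | (∀ j, (G : ℤ) + 1 ≤ Z j ∧ Z j ≤ 2 * (G : ℤ) + Nat.log 2 p) ∧
      Finset.univ.gcd (fun j => b j + Z j) ≠ 1} ⊆
      ⋃ g ∈ Finset.Ioc 1 M, Set.univ.pi fun j => {z : ℤ | (g : ℤ) ∣ b j + z} := by
    rintro Z ⟨hZ, hne⟩
    set d := Finset.univ.gcd (fun j => b j + Z j) with hd
    have hdvd : ∀ j, d ∣ b j + Z j := fun j => Finset.gcd_dvd (Finset.mem_univ j)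
    have h0 : 0 ≤ d := by
      have h1 : normalize d = d := Finset.normalize_gcd
      rw [← Int.abs_eq_normalize] at h1
      exact h1 ▸ abs_nonneg d
    let j₀ : Fin p := ⟨0, by omega⟩
    have hj := hZ j₀
    have hbj := abs_le.1 (hb j₀)
    have hpos : 0 < b j₀ + Z j₀ := by omega
    have hle := Int.le_of_dvd hpos (hdvd j₀)
    have hd0 : d ≠ 0 := fun h => by
      have := hdvd j₀
      rw [h, zero_dvd_iff] at this
      omega
    rw [Set.mem_iUnion₂]
    refine ⟨d.toNat, Finset.mem_Ioc.2 ⟨by omega, by omega⟩, fun j _ => ?_⟩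
    rw [Set.mem_ofPred_eq, Int.toNat_of_nonneg h0]
    exact hdvd j
  refine (measure_mono hsub).trans ((measure_biUnion_finset_le _ _).trans ?_)
  have hL6 : (6 : ℝ) ≤ L := by exact_mod_cast hG.trans (Nat.le_add_right _ _)
  have hML : (M : ℝ) ≤ 3 * L := by exact_mod_cast (show M ≤ 3 * L by omega)
  have hterm : ∀ g ∈ Finset.Ioc 1 M,
      translationLaw p G (Set.univ.pi fun j => {z : ℤ | (g : ℤ) ∣ b j + z}) ≤
        ENNReal.ofReal (16 * (2 / 3) ^ (p - 2) * ((g : ℝ) ^ 2)⁻¹) := by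
    intro g hg
    obtain ⟨hg1, hg2⟩ := Finset.mem_Ioc.1 hg
    have hgR : (2 : ℝ) ≤ g := by exact_mod_cast hg1
    have hgM : (g : ℝ) ≤ 3 * L := le_trans (by exact_mod_cast hg2) hML
    have hLe : ((2 * (G : ℤ) + Nat.log 2 p - G : ℤ) : ℝ) = L := by rw [hL]; push_cast; ring
    rw [translationLaw, Measure.pi_pi]
    have h1 : ∀ j, uniformOn (Set.Icc ((G : ℤ) + 1) (2 * (G : ℤ) + (Nat.log 2 p : ℤ)))
        {z : ℤ | (g : ℤ) ∣ b j + z} ≤ ENNReal.ofReal (1 / g + 1 / L) := fun j => by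
      have := uniformOn_dvd_le (show (G : ℤ) < 2 * G + Nat.log 2 p by omega) (b j)
        (show 0 < g by omega)
      rwa [hLe] at this
    have hx0 : (0 : ℝ) ≤ 1 / g + 1 / L := by positivity
    have hx1 : (1 : ℝ) / g + 1 / L ≤ 2 / 3 := by
      have e1 : (1 : ℝ) / g ≤ 1 / 2 := one_div_le_one_div_of_le (by norm_num) hgR
      have e2 : (1 : ℝ) / L ≤ 1 / 6 := one_div_le_one_div_of_le (by norm_num) hL6
      linarith
    have hx2 : (1 : ℝ) / g + 1 / L ≤ 4 / g := by
      have e1 : (1 : ℝ) / L ≤ 3 / g := by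
        rw [div_le_div_iff₀ (by linarith) (by linarith)]
        linarith
      have e2 : (4 : ℝ) / g = 1 / g + 3 / g := by ring
      linarith
    calc _ ≤ ∏ _j : Fin p, ENNReal.ofReal (1 / g + 1 / L) := Finset.prod_le_prod' fun j _ => h1 j
      _ = ENNReal.ofReal ((1 / g + 1 / L) ^ p) := by
          rw [Finset.prod_const, Finset.card_univ, Fintype.card_fin, ENNReal.ofReal_pow hx0]
      _ ≤ _ := by
          refine ENNReal.ofReal_le_ofReal ?_
          -- Two of the `p` factors are estimated by `4 / g`, to make the sum over `g` converge; the
          -- others by `2 / 3`, to get exponential decay.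
          calc ((1 : ℝ) / g + 1 / L) ^ p = (1 / g + 1 / L) ^ (p - 2) * (1 / g + 1 / L) ^ 2 := by
                rw [← pow_add]
                congr 1
                omega
            _ ≤ (2 / 3) ^ (p - 2) * (4 / g) ^ 2 := by gcongr
            _ = _ := by rw [div_pow]; ring
  refine (Finset.sum_le_sum hterm).trans ?_
  rw [← ENNReal.ofReal_sum_of_nonneg fun g _ => by positivity, ← Finset.mul_sum]
  refine ENNReal.ofReal_le_ofReal ?_
  have hs := sum_Ioc_inv_sq_le_sub (α := ℝ) one_ne_zero (show 1 ≤ M by omega)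
  have hM0 : (0 : ℝ) ≤ (M : ℝ)⁻¹ := by positivity
  have hs' : ∑ g ∈ Finset.Ioc 1 M, ((g : ℝ) ^ 2)⁻¹ ≤ 1 := by
    refine hs.trans ?_
    rw [Nat.cast_one, inv_one]
    linarith
  calc _ ≤ (16 : ℝ) * (2 / 3) ^ (p - 2) * 1 := by gcongr
    _ = _ := mul_one _

end ELO

/-! ### The recovery probability of the LBR algorithm -/

namespace LBR

variable {n p : ℕ}

theorem measurable_trunc (N : ℕ) : Measurable (trunc N) := by
  have h : trunc N = fun x : ℝ => if 0 < x then ⌊2 ^ N * |x|⌋ else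
      if x < 0 then -⌊2 ^ N * |x|⌋ else 0 := by
    funext x
    unfold trunc
    rcases lt_trichotomy x 0 with h | rfl | h
    · simp [sign_neg h, h, h.not_gt]
    · simp
    · simp [sign_pos h, h]
  rw [h]
  have hm : Measurable fun x : ℝ => ⌊2 ^ N * |x|⌋ :=
    Int.measurable_floor.comp (measurable_const.mul measurable_abs)
  exact Measurable.ite measurableSet_Ioi hm (Measurable.ite measurableSet_Iio hm.neg
    measurable_const)

/-- After truncation the algorithm is a function on a countable discrete space, so nothing about LLL
has to be examined. -/
theorem measurable_run (N Q Rh What : ℕ) (Z : Fin p → ℤ) :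
    Measurable fun d : (Fin n → ℝ) × (Fin n → Fin p → ℝ) => run d.1 d.2 N Q Rh What Z := by
  have h1 : Measurable fun d : (Fin n → ℝ) × (Fin n → Fin p → ℝ) =>
      ((fun i => trunc N (d.1 i), fun i j => trunc N (d.2 i j)) :
        (Fin n → ℤ) × (Fin n → Fin p → ℤ)) := by
    refine Measurable.prodMk (measurable_pi_lambda _ fun i => ?_)
      (measurable_pi_lambda _ fun i => measurable_pi_lambda _ fun j => ?_)
    · exact (measurable_trunc N).comp ((measurable_pi_apply i).comp measurable_fst)
    · exact (measurable_trunc N).comp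
        ((measurable_pi_apply j).comp ((measurable_pi_apply i).comp measurable_snd))
  let F : (Fin n → ℤ) × (Fin n → Fin p → ℤ) → Fin p → ℝ := fun e j =>
    ELO.run (fun i => (Q : ℤ) * e.1 i) e.2 (Q * Rh) (2 * Q * (2 ^ N * What + Rh * p)) Z j / (Q : ℝ)
  have h2 : Measurable F := measurable_of_countable F
  have h3 : (fun d : (Fin n → ℝ) × (Fin n → Fin p → ℝ) => run d.1 d.2 N Q Rh What Z) =
      fun d => F (fun i => trunc N (d.1 i), fun i j => trunc N (d.2 i j)) := by
    funext d j
    simp only [run, F]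
  rw [h3]
  exact h2.comp h1

theorem measurable_observe (β : Fin p → ℝ) :
    Measurable fun XW : (Fin n → Fin p → ℝ) × (Fin n → ℝ) =>
      ((fun i => (∑ j, XW.1 i j * β j) + XW.2 i, XW.1) :
        (Fin n → ℝ) × (Fin n → Fin p → ℝ)) := by
  fun_prop

/-- A bound on the probability that the random data violate one of the conditions of `run_eq`. -/
noncomputable def failureBound (c K : ℝ) (n p G N : ℕ) : ℝ :=
  n * (1 / (p : ℝ) ^ 2) + n * (p * K / (p : ℝ) ^ 3) + n * (2 * c * (1 / (p : ℝ) ^ 2)) +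
    (2 * (shortBound n p G : ℕ) + 1) ^ p *
      ((2 * (4 * shortBound n p G * p ^ 5 : ℕ) + 1) *
        (2 * c * ((74 * shortBound n p G * G * p ^ 7 : ℕ) / 2 ^ N))) ^ n

/-- Here `Z` is fixed and good. Outside four events (a large noise entry, a large row of `X`, a
small entry of `X (b + Z)`, a spurious approximate relation) `run_eq` applies. The additive form
avoids truncated subtraction in `ℝ≥0∞`. -/
theorem one_le_dataLaw_run_add {D : Measure ℝ} [IsProbabilityMeasure D] {c : ℝ} (hc : 0 ≤ c)
    (hD : HasDensityBoundedBy D c) (hmoment : Integrable (fun v : ℝ => v) D)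
    (hn : 0 < n) (hnp : n ≤ p) {N Q Rh : ℕ} (hQ : 0 < Q) (hRh : 0 < Rh) {σ : ℝ} (hσ : 0 < σ)
    {b Z : Fin p → ℤ} (hb : ∀ j, |b j| ≤ (Q * Rh : ℕ))
    (hZ : ∀ j, ((Q * Rh : ℕ) : ℤ) + 1 ≤ Z j ∧ Z j ≤ 2 * ((Q * Rh : ℕ) : ℤ) + Nat.log 2 p)
    (hgcd : Finset.univ.gcd (fun j => b j + Z j) = 1)
    (hN : 2 * p ^ 2 * shortBound n p (Q * Rh) < 2 ^ N) (hNσ : 2 ^ N * σ ≤ 1) :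
    1 ≤ dataLaw n D σ (fun j => (b j : ℝ) / Q)
        {d | run d.1 d.2 N Q Rh 1 Z = fun j => (b j : ℝ) / Q} +
      ENNReal.ofReal (failureBound c (∫ x, |x| ∂D) n p (Q * Rh) N) := by
  have hp : 0 < p := hn.trans_le hnp
  have hpR : (0 : ℝ) < p := by exact_mod_cast hp
  have hK : 0 ≤ ∫ x, |x| ∂D := integral_nonneg fun x => abs_nonneg x
  obtain ⟨K, hKdef⟩ : ∃ K, K = ∫ x, |x| ∂D := ⟨_, rfl⟩
  rw [← hKdef] at hK ⊢
  obtain ⟨A, hA⟩ : ∃ A, A = shortBound n p (Q * Rh) := ⟨_, rfl⟩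
  obtain ⟨G, hG⟩ : ∃ G, G = Q * Rh := ⟨_, rfl⟩
  set μX : Measure (Fin n → Fin p → ℝ) := Measure.pi fun _ : Fin n => Measure.pi fun _ : Fin p => D
  set γ := gaussianReal 0 (Real.toNNReal (σ ^ 2)) with hγ
  set μW : Measure (Fin n → ℝ) := Measure.pi fun _ : Fin n => γ
  set S := {d : (Fin n → ℝ) × (Fin n → Fin p → ℝ) |
    run d.1 d.2 N Q Rh 1 Z = fun j => (b j : ℝ) / Q} with hS
  have hSm : MeasurableSet S := measurable_run N Q Rh 1 Z (measurableSet_singleton _)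
  have hobs := measurable_observe (n := n) fun j => (b j : ℝ) / Q
  set T := (fun XW : (Fin n → Fin p → ℝ) × (Fin n → ℝ) =>
      ((fun i => (∑ j, XW.1 i j * ((b j : ℝ) / Q)) + XW.2 i, XW.1) :
        (Fin n → ℝ) × (Fin n → Fin p → ℝ))) ⁻¹' S with hT
  have hTm : MeasurableSet T := hobs hSm
  have hmap : dataLaw n D σ (fun j => (b j : ℝ) / Q) S = (μX.prod μW) T :=
    Measure.map_apply hobs hSm
  rw [hmap]
  set B1 : Set (Fin n → ℝ) := {W | ∃ i, W i ∈ {w : ℝ | p * σ ≤ |w|}} with hB1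
  set B2 : Set (Fin n → Fin p → ℝ) :=
    {X | ∃ i, X i ∈ {x : Fin p → ℝ | (p : ℝ) ^ 3 ≤ ∑ j, |x j|}} with hB2
  set B3 : Set (Fin n → Fin p → ℝ) :=
    {X | ∃ i, X i ∈ {x : Fin p → ℝ | |∑ j, x j * ((b j + Z j : ℤ) : ℝ)| ≤ 1 / (p : ℝ) ^ 2}} with hB3
  set B4 : Set (Fin n → Fin p → ℝ) :=
    {X | ∃ v : Fin p → ℤ, (∀ j, |v j| ≤ A) ∧ (∀ l : ℤ, ∃ j, v j ≠ l * (b j + Z j)) ∧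
        ∀ i, ∃ y : ℤ, |y| ≤ (4 * A * p ^ 5 : ℕ) ∧
          |∑ j, X i j * ((v j - y * (b j + Z j) : ℤ) : ℝ)| ≤
            (74 * A * G * p ^ 7 : ℕ) / 2 ^ N} with hB4
  have hsub : Tᶜ ⊆ (Set.univ ×ˢ B1 ∪ B2 ×ˢ Set.univ) ∪ B3 ×ˢ Set.univ ∪ B4 ×ˢ Set.univ := by
    rintro ⟨X, W⟩ hXW
    by_contra hnot
    simp only [Set.mem_union, Set.mem_prod, Set.mem_univ, true_and, and_true, not_or] at hnot
    obtain ⟨⟨⟨h1, h2⟩, h3⟩, h4⟩ := hnot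
    simp only [hB1, hB2, hB3, Set.mem_ofPred_eq, not_exists, not_le] at h1 h2 h3
    refine hXW ?_
    rw [hT, Set.mem_preimage, hS, Set.mem_ofPred_eq]
    refine run_eq hn hnp N Q Rh hQ hRh X W b Z hb hZ hgcd hN (fun i => ?_) (fun i => (h2 i).le)
      h3 fun v hv hl => ?_
    · calc 2 ^ N * |W i| ≤ 2 ^ N * (p * σ) := by gcongr; exact (h1 i).le
        _ = p * (2 ^ N * σ) := by ring
        _ ≤ p * 1 := by gcongr
        _ = p := mul_one _
    · rw [← hA] at hv ⊢
      rw [← hG]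
      by_contra! hcon
      refine h4 ⟨v, hv, hl, fun i => ?_⟩
      obtain ⟨y, hy1, hy2⟩ := hcon i
      refine ⟨y, hy1, ?_⟩
      rw [le_div_iff₀ (by positivity), mul_comm]
      exact hy2
  have hp1 : μW B1 ≤ n * ENNReal.ofReal (1 / (p : ℝ) ^ 2) := by
    refine (pi_exists_le γ (measurableSet_le measurable_const measurable_abs)).trans ?_
    gcongr
    refine (gaussianReal_abs_ge_le σ (by positivity)).trans (le_of_eq ?_)
    congr 1
    field_simp
  have hp2 : μX B2 ≤ n * ENNReal.ofReal (p * K / (p : ℝ) ^ 3) := by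
    refine (pi_exists_le _ (measurableSet_le measurable_const ?_)).trans ?_
    · fun_prop
    gcongr
    rw [hKdef]
    exact pi_sum_abs_ge_le D hmoment p (by positivity)
  have hp3 : μX B3 ≤ n * ENNReal.ofReal (2 * c * (1 / (p : ℝ) ^ 2)) := by
    refine (pi_exists_le _ (measurableSet_le ?_ measurable_const)).trans ?_
    · fun_prop
    gcongr
    refine hD.pi_le hc (fun j => ((b j + Z j : ℤ) : ℝ)) (j₀ := ⟨0, hp⟩) ?_ _
    have h1 := abs_le.1 (hb ⟨0, hp⟩)
    have h2 := (hZ ⟨0, hp⟩).1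
    exact_mod_cast Int.one_le_abs (show b ⟨0, hp⟩ + Z ⟨0, hp⟩ ≠ 0 by omega)
  have hp4 : μX B4 ≤ _ := pi_exists_relation_le hc hD (n := n) (fun j => b j + Z j) A
    (4 * A * p ^ 5) (h := (74 * A * G * p ^ 7 : ℕ) / 2 ^ N) (by positivity)
  have hcompl : (μX.prod μW) Tᶜ ≤
      ENNReal.ofReal (failureBound c K n p (Q * Rh) N) := by
    refine (measure_mono hsub).trans ?_
    refine (measure_union_le _ _).trans ?_
    refine (add_le_add ((measure_union_le _ _).trans (add_le_add (measure_union_le _ _) le_rfl))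
      le_rfl).trans ?_
    rw [Measure.prod_prod, Measure.prod_prod, Measure.prod_prod, Measure.prod_prod, measure_univ,
      measure_univ, one_mul, mul_one, mul_one, mul_one]
    refine (add_le_add (add_le_add (add_le_add hp1 hp2) hp3) hp4).trans (le_of_eq ?_)
    rw [failureBound, ← hA, ← hG, ← ENNReal.ofReal_natCast n,
      ← ENNReal.ofReal_mul (Nat.cast_nonneg n), ← ENNReal.ofReal_mul (Nat.cast_nonneg n),
      ← ENNReal.ofReal_mul (Nat.cast_nonneg n), ← ENNReal.ofReal_add (by positivity) (by positivity),
      ← ENNReal.ofReal_add (by positivity) (by positivity),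
      ← ENNReal.ofReal_add (by positivity) (by positivity)]
  calc (1 : ℝ≥0∞) = (μX.prod μW) T + (μX.prod μW) Tᶜ := by
        rw [measure_add_measure_compl hTm, measure_univ]
    _ ≤ _ := by gcongr

theorem isProbabilityMeasure_dataLaw (D : Measure ℝ) [IsProbabilityMeasure D] (σ : ℝ)
    (β : Fin p → ℝ) : IsProbabilityMeasure (dataLaw n D σ β) :=
  Measure.isProbabilityMeasure_map (measurable_observe β).aemeasurable

theorem law_apply (N Q Rh What : ℕ) (d : (Fin n → ℝ) × (Fin n → Fin p → ℝ)) (β : Fin p → ℝ) :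
    law N Q Rh What d {β} = ELO.translationLaw p (Q * Rh) {Z | run d.1 d.2 N Q Rh What Z = β} := by
  rw [law, Measure.map_apply (measurable_of_countable _) (measurableSet_singleton _)]
  rfl

theorem recoveryProb_law_le_one {D : Measure ℝ} [IsProbabilityMeasure D] (N : ℕ) {Q Rh : ℕ}
    (hQ : 0 < Q) (hRh : 0 < Rh) (What : ℕ) (σ : ℝ) (β : Fin p → ℝ) :
    recoveryProb (n := n) D σ β (law N Q Rh What) ≤ 1 := by
  have := ELO.isProbabilityMeasure_translationLaw p (Nat.mul_pos hQ hRh)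
  have := isProbabilityMeasure_dataLaw (n := n) D σ β
  calc _ ≤ ∫⁻ _, 1 ∂(dataLaw n D σ β) := lintegral_mono fun d => by
        rw [law_apply]
        exact prob_le_one
    _ = 1 := by simp

/-- Tonelli exchanges data and translation, since `Z` is independent of the data; the previous bound
then holds for each good `Z`, and the good `Z` are likely. -/
theorem le_recoveryProb_law {D : Measure ℝ} [IsProbabilityMeasure D] {c : ℝ} (hc : 0 ≤ c)
    (hD : HasDensityBoundedBy D c) (hmoment : Integrable (fun v : ℝ => v) D)
    (hn : 0 < n) (hnp : n ≤ p) (hp : 2 ≤ p) {N Q Rh : ℕ} (hQ : 0 < Q) (hRh : 0 < Rh)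
    (hG : 6 ≤ Q * Rh) {σ : ℝ} (hσ : 0 < σ) {b : Fin p → ℤ} (hb : ∀ j, |b j| ≤ (Q * Rh : ℕ))
    (hN : 2 * p ^ 2 * shortBound n p (Q * Rh) < 2 ^ N) (hNσ : 2 ^ N * σ ≤ 1) :
    (1 - ENNReal.ofReal (failureBound c (∫ x, |x| ∂D) n p (Q * Rh) N)) *
      (1 - ENNReal.ofReal (16 * (2 / 3) ^ (p - 2))) ≤
      recoveryProb (n := n) D σ (fun j => (b j : ℝ) / Q) (law N Q Rh 1) := by
  have := ELO.isProbabilityMeasure_translationLaw p (Nat.mul_pos hQ hRh)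
  have := isProbabilityMeasure_dataLaw (n := n) D σ fun j => (b j : ℝ) / Q
  set τ := ELO.translationLaw p (Q * Rh) with hτ
  set ν := dataLaw n D σ fun j => (b j : ℝ) / Q with hν
  set S : Set (((Fin n → ℝ) × (Fin n → Fin p → ℝ)) × (Fin p → ℤ)) :=
    {e | run e.1.1 e.1.2 N Q Rh 1 e.2 = fun j => (b j : ℝ) / Q} with hS
  have hSm : MeasurableSet S := by
    have : Measurable fun e : ((Fin n → ℝ) × (Fin n → Fin p → ℝ)) × (Fin p → ℤ) =>
        run e.1.1 e.1.2 N Q Rh 1 e.2 :=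
      measurable_from_prod_countable_left fun Z => measurable_run N Q Rh 1 Z
    exact this (measurableSet_singleton _)
  have hrec : recoveryProb (n := n) D σ (fun j => (b j : ℝ) / Q) (law N Q Rh 1) =
      ∫⁻ Z, ν ((fun d => (d, Z)) ⁻¹' S) ∂τ := by
    rw [← Measure.prod_apply_symm hSm, Measure.prod_apply hSm, recoveryProb]
    refine lintegral_congr fun d => ?_
    rw [law_apply]
    rfl
  rw [hrec]
  set box : Set (Fin p → ℤ) := {Z | ∀ j, ((Q * Rh : ℕ) : ℤ) + 1 ≤ Z j ∧
    Z j ≤ 2 * ((Q * Rh : ℕ) : ℤ) + Nat.log 2 p} with hbox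
  set good : Set (Fin p → ℤ) := {Z | Z ∈ box ∧ Finset.univ.gcd (fun j => b j + Z j) = 1} with hgood
  have hgm : MeasurableSet good := MeasurableSet.of_discrete
  have hτg : 1 - ENNReal.ofReal (16 * (2 / 3) ^ (p - 2)) ≤ τ good := by
    rw [tsub_le_iff_right, ← measure_univ (μ := τ), ← measure_add_measure_compl hgm]
    gcongr
    have hsub : goodᶜ ⊆ {Z | ¬ Z ∈ box} ∪
        {Z | Z ∈ box ∧ Finset.univ.gcd (fun j => b j + Z j) ≠ 1} := by
      intro Z hZ
      by_cases h : Z ∈ box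
      · exact Or.inr ⟨h, fun h' => hZ ⟨h, h'⟩⟩
      · exact Or.inl h
    refine (measure_mono hsub).trans ((measure_union_le _ _).trans ?_)
    have h1 : τ {Z | ¬ Z ∈ box} = 0 := ELO.translationLaw_box_compl p (Nat.mul_pos hQ hRh)
    rw [h1, zero_add]
    exact ELO.translationLaw_gcd_ne_one_le hp hG b hb
  calc _ ≤ (1 - ENNReal.ofReal (failureBound c (∫ x, |x| ∂D) n p (Q * Rh) N)) * τ good := by gcongr
    _ = ∫⁻ _ in good, (1 - ENNReal.ofReal (failureBound c (∫ x, |x| ∂D) n p (Q * Rh) N)) ∂τ := by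
        rw [setLIntegral_const]
    _ ≤ ∫⁻ Z in good, ν ((fun d => (d, Z)) ⁻¹' S) ∂τ := by
        refine setLIntegral_mono' hgm fun Z hZ => ?_
        rw [tsub_le_iff_right]
        exact one_le_dataLaw_run_add hc hD hmoment hn hnp hQ hRh hσ hb hZ.1 hZ.2 hN hNσ
    _ ≤ _ := setLIntegral_le_lintegral _ _

end LBR

/-! ### Asymptotics of the recovery probability -/

/-! ### Every quantity bounded by a power of two. -/

theorem mul_le_two_rpow {a b x y : ℝ} (hb : 0 ≤ b) (ha : a ≤ (2 : ℝ) ^ x)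
    (hb' : b ≤ (2 : ℝ) ^ y) : a * b ≤ (2 : ℝ) ^ (x + y) := by
  rw [Real.rpow_add two_pos]
  exact mul_le_mul ha hb' hb (Real.rpow_nonneg two_pos.le _)

theorem pow_le_two_rpow {a x : ℝ} (ha : 0 ≤ a) (h : a ≤ (2 : ℝ) ^ x) (k : ℕ) :
    a ^ k ≤ (2 : ℝ) ^ (k * x) := by
  rw [mul_comm, Real.rpow_mul two_pos.le, Real.rpow_natCast]
  exact pow_le_pow_left₀ ha h k

theorem two_mul_add_one_le {a x : ℝ} (hx : 0 ≤ x) (h : a ≤ (2 : ℝ) ^ x) :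
    2 * a + 1 ≤ (2 : ℝ) ^ (x + 2) := by
  have h1 : (1 : ℝ) ≤ 2 ^ x := Real.one_le_rpow (by norm_num) hx
  rw [Real.rpow_add two_pos, show (2 : ℝ) ^ (2 : ℝ) = 4 by norm_num]
  linarith

theorem le_two_rpow_mono {a x y : ℝ} (h : a ≤ (2 : ℝ) ^ x) (hxy : x ≤ y) : a ≤ (2 : ℝ) ^ y :=
  h.trans (Real.rpow_le_rpow_of_exponent_le (by norm_num) hxy)

theorem natCast_le_two_rpow (p : ℕ) : (p : ℝ) ≤ (2 : ℝ) ^ (p : ℝ) := by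
  rw [Real.rpow_natCast]
  exact_mod_cast Nat.lt_two_pow_self.le

theorem sigmaZero_rpow (n p Q : ℕ) (R t : ℝ) :
    sigmaZero n p Q R ^ t = (2 : ℝ) ^ (-(p * Real.logb 2 (R * Q) / n * t)) := by
  rw [sigmaZero, ← Real.rpow_mul two_pos.le, neg_mul]

namespace LBR

/-- The level `N = ⌊log₂ (1 / σ)⌋` is as fine as possible while `2 ^ N σ ≤ 1`; rounding costs one
bit. -/
theorem truncation_bounds {n p Q : ℕ} {R σ ε : ℝ} (hσ : 0 < σ)
    (hy : 0 ≤ p * Real.logb 2 (R * Q) / n * (1 + ε))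
    (hs : σ < sigmaZero n p Q R ^ (1 + ε)) :
    (2 : ℝ) ^ ⌊Real.logb 2 (1 / σ)⌋₊ * σ ≤ 1 ∧
    (2 : ℝ) ^ (p * Real.logb 2 (R * Q) / n * (1 + ε) - 1) ≤
      (2 : ℝ) ^ ⌊Real.logb 2 (1 / σ)⌋₊ := by
  rw [sigmaZero_rpow] at hs
  set y := p * Real.logb 2 (R * Q) / n * (1 + ε)
  have h1 : Real.logb 2 σ < -y := (Real.logb_lt_iff_lt_rpow (by norm_num) hσ).2 hs
  have h2 : Real.logb 2 (1 / σ) = -Real.logb 2 σ := by rw [one_div, Real.logb_inv]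
  rw [h2]
  constructor
  · have h3 : (⌊-Real.logb 2 σ⌋₊ : ℝ) ≤ -Real.logb 2 σ := Nat.floor_le (by linarith)
    have h4 : (2 : ℝ) ^ ⌊-Real.logb 2 σ⌋₊ ≤ (2 : ℝ) ^ (-Real.logb 2 σ) := by
      rw [← Real.rpow_natCast]
      exact Real.rpow_le_rpow_of_exponent_le (by norm_num) h3
    rw [Real.rpow_neg two_pos.le, Real.rpow_logb two_pos (by norm_num) hσ] at h4
    calc _ ≤ σ⁻¹ * σ := by gcongr
      _ = 1 := inv_mul_cancel₀ hσ.ne'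
  · rw [← Real.rpow_natCast]
    refine Real.rpow_le_rpow_of_exponent_le (by norm_num) ?_
    have := Nat.lt_floor_add_one (-Real.logb 2 σ)
    linarith

theorem natCast_mul_ceil_le {Q : ℕ} (hQ : 0 < Q) {R : ℝ} (hR : 1 ≤ R) :
    ((Q * ⌈R⌉₊ : ℕ) : ℝ) ≤ (2 : ℝ) ^ (Real.logb 2 (R * Q) + 1) := by
  have hQ' : (0 : ℝ) < Q := by exact_mod_cast hQ
  -- For `R ≥ 1` rounding up at most doubles `R`, whence the `+ 1` in the exponent.
  rw [Real.rpow_add two_pos, Real.rpow_logb two_pos (by norm_num) (by positivity), Real.rpow_one]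
  have := Nat.ceil_lt_add_one (show 0 ≤ R by linarith)
  push_cast
  calc (Q : ℝ) * ⌈R⌉₊ ≤ Q * (R + R) := by gcongr; linarith
    _ = _ := by ring

theorem shortBound_le {n p G : ℕ} (hp : 1 ≤ p) (hnp : n ≤ p) {L : ℝ}
    (hG : (G : ℝ) ≤ (2 : ℝ) ^ (L + 1)) :
    (shortBound n p G : ℝ) ≤ (2 : ℝ) ^ (L + 10 * p) := by
  have hp' : (1 : ℝ) ≤ p := by exact_mod_cast hp
  have hnp' : (n : ℝ) ≤ p := by exact_mod_cast hnp
  have h1 : (15 : ℝ) ≤ (2 : ℝ) ^ (4 : ℝ) := by norm_num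
  have h2 : (2 : ℝ) ^ (n + p) ≤ (2 : ℝ) ^ ((n + p : ℕ) : ℝ) := by rw [Real.rpow_natCast]
  have h3 := pow_le_two_rpow (Nat.cast_nonneg p) (natCast_le_two_rpow p) 3
  have h4 := mul_le_two_rpow (by positivity) (mul_le_two_rpow (by positivity)
    (mul_le_two_rpow (by positivity) h1 h2) hG) h3
  unfold shortBound
  push_cast at h4 ⊢
  exact le_two_rpow_mono h4 (by linarith)

/-- In `hx`, `p (L + 12 p)` counts the vectors `v`. Each row contributes `L + 19 p` for the choices
of `y`, `p` for the density and `2 L + 25 p + 1 - x` for the ball radius. -/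
theorem failureBound_le {n p G N : ℕ} {c K L x : ℝ} (hc : 0 ≤ c) (hK : 0 ≤ K) (hp : 1 ≤ p)
    (hnp : n ≤ p) (hL : 0 ≤ L) (hG : (G : ℝ) ≤ (2 : ℝ) ^ (L + 1)) (hcp : 2 * c ≤ (2 : ℝ) ^ (p : ℝ))
    (hN : (2 : ℝ) ^ (x - 1) ≤ (2 : ℝ) ^ N)
    (hx : p * (L + 12 * p) + n * (3 * L + 46 * p) - n * x ≤ -p) :
    failureBound c K n p G N ≤ (1 + K + 2 * c) / p + (2 : ℝ) ^ (-(p : ℝ)) := by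
  have hp' : (1 : ℝ) ≤ p := by exact_mod_cast hp
  have hnp' : (n : ℝ) ≤ p := by exact_mod_cast hnp
  have hA := shortBound_le hp hnp hG
  rw [failureBound]
  obtain ⟨A, hAdef⟩ : ∃ A, A = shortBound n p G := ⟨_, rfl⟩
  rw [← hAdef] at hA ⊢
  have hpp := natCast_le_two_rpow p
  refine add_le_add ?_ ?_
  · have e : (n : ℝ) * (1 / (p : ℝ) ^ 2) + n * (p * K / (p : ℝ) ^ 3) +
        n * (2 * c * (1 / (p : ℝ) ^ 2)) = n * ((1 + K + 2 * c) / (p : ℝ) ^ 2) := by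
      field_simp
    rw [e]
    calc (n : ℝ) * ((1 + K + 2 * c) / (p : ℝ) ^ 2) ≤ p * ((1 + K + 2 * c) / (p : ℝ) ^ 2) := by
          gcongr
      _ = _ := by field_simp
  · have h1 : 2 * (A : ℝ) + 1 ≤ (2 : ℝ) ^ (L + 12 * p) :=
      le_two_rpow_mono (two_mul_add_one_le (by positivity) hA) (by linarith)
    have h2 : 2 * ((4 * A * p ^ 5 : ℕ) : ℝ) + 1 ≤ (2 : ℝ) ^ (L + 19 * p) := by
      have e1 : (4 : ℝ) ≤ (2 : ℝ) ^ (2 : ℝ) := by norm_num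
      have e2 := mul_le_two_rpow (by positivity) (mul_le_two_rpow (by positivity) e1 hA)
        (pow_le_two_rpow (by positivity) hpp 5)
      push_cast at e2 ⊢
      exact le_two_rpow_mono (two_mul_add_one_le (by positivity) e2) (by linarith)
    have h3 : ((74 * A * G * p ^ 7 : ℕ) : ℝ) ≤ (2 : ℝ) ^ (2 * L + 25 * p) := by
      have e1 : (74 : ℝ) ≤ (2 : ℝ) ^ (7 : ℝ) := by norm_num
      have e2 := mul_le_two_rpow (by positivity) (mul_le_two_rpow (by positivity)
        (mul_le_two_rpow (by positivity) e1 hA) hG) (pow_le_two_rpow (by positivity) hpp 7)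
      push_cast at e2 ⊢
      exact le_two_rpow_mono e2 (by linarith)
    have h4 : ((74 * A * G * p ^ 7 : ℕ) : ℝ) / 2 ^ N ≤
        (2 : ℝ) ^ (2 * L + 25 * p + -(x - 1)) := by
      rw [div_eq_mul_inv]
      refine mul_le_two_rpow (by positivity) h3 ?_
      rw [Real.rpow_neg two_pos.le]
      exact inv_anti₀ (by positivity) hN
    have h5 := mul_le_two_rpow (by positivity) h2 (mul_le_two_rpow (by positivity) hcp h4)
    have h6 := mul_le_two_rpow (by positivity) (pow_le_two_rpow (by positivity) h1 p)
      (pow_le_two_rpow (by positivity) h5 n)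
    refine le_two_rpow_mono h6 ?_
    have : (n : ℝ) * (3 * L + 45 * p + 1) ≤ n * (3 * L + 46 * p) :=
      mul_le_mul_of_nonneg_left (by linarith) (by positivity)
    nlinarith

/-- The conditions of the recovery theorem hold, and its failure probability is small, as soon as
`n / p` and `p / log (R Q)` are small enough. -/
theorem recovery_bounds {n p Q : ℕ} {R σ c K ε η : ℝ} (hn : 0 < n) (hp : 1 ≤ p) (hQ : 0 < Q)
    (hR : 1 ≤ R) (hσ : 0 < σ) (hc : 0 ≤ c) (hK : 0 ≤ K) (hε : 0 < ε) (hη : 0 < η)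
    (hη1 : 16 * η ≤ 1) (hη2 : 61 * η ≤ ε / 2) (hpL : p ≤ η * Real.logb 2 (R * Q))
    (hL : 1 ≤ ε / 2 * Real.logb 2 (R * Q)) (hnη : n ≤ η * p) (hcp : 2 * c ≤ (2 : ℝ) ^ (p : ℝ))
    (hs : σ < sigmaZero n p Q R ^ (1 + ε)) :
    (2 : ℝ) ^ ⌊Real.logb 2 (1 / σ)⌋₊ * σ ≤ 1 ∧
    2 * p ^ 2 * shortBound n p (Q * ⌈R⌉₊) < 2 ^ ⌊Real.logb 2 (1 / σ)⌋₊ ∧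
    failureBound c K n p (Q * ⌈R⌉₊) ⌊Real.logb 2 (1 / σ)⌋₊ ≤
      (1 + K + 2 * c) / p + (2 : ℝ) ^ (-(p : ℝ)) := by
  have hp' : (1 : ℝ) ≤ p := by exact_mod_cast hp
  have hn' : (1 : ℝ) ≤ n := by exact_mod_cast hn
  have hG := natCast_mul_ceil_le hQ hR
  have hnpR : (n : ℝ) ≤ p := by nlinarith
  have hnp : n ≤ p := by exact_mod_cast hnpR
  set L := Real.logb 2 (R * Q) with hLdef
  have hL0 : 0 ≤ L := by
    by_contra h
    nlinarith [not_le.1 h]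
  obtain ⟨h1, h2⟩ := truncation_bounds hσ (by rw [← hLdef]; positivity) hs
  rw [← hLdef] at h2
  refine ⟨h1, ?_, failureBound_le hc hK hp hnp hL0 hG hcp h2 ?_⟩
  · have hA := shortBound_le hp hnp hG
    have e1 : (2 : ℝ) ≤ (2 : ℝ) ^ (1 : ℝ) := by norm_num
    have e2 := mul_le_two_rpow (by positivity) (mul_le_two_rpow (by positivity) e1
      (pow_le_two_rpow (by positivity) (natCast_le_two_rpow p) 2)) hA
    have e3 : (1 : ℝ) + (2 : ℕ) * p + (L + 10 * p) < p * L / n * (1 + ε) - 1 := by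
      have e4 : 16 * L ≤ p * L / n := by
        rw [le_div_iff₀ (by linarith)]
        have : 16 * (n : ℝ) ≤ p := by nlinarith
        nlinarith
      have e5 : p * L / n ≤ p * L / n * (1 + ε) := by
        have : 0 ≤ p * L / n := by positivity
        nlinarith
      have e6 : 16 * (p : ℝ) ≤ L := by nlinarith
      push_cast
      linarith
    have e4 := (e2.trans_lt (Real.rpow_lt_rpow_of_exponent_lt (by norm_num) e3)).trans_le h2
    exact_mod_cast e4
  · have e1 : (n : ℝ) * (p * L / n * (1 + ε)) = p * L * (1 + ε) := by
      field_simp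
    rw [e1]
    have e2 : (p : ℝ) * p ≤ p * (η * L) := by gcongr
    have e3 : (n : ℝ) * L ≤ η * p * L := by gcongr
    have e4 : (n : ℝ) * p ≤ p * p := by gcongr
    have e5 : 61 * η * (p * L) ≤ ε / 2 * (p * L) := by gcongr
    have e6 : (p : ℝ) * 1 ≤ p * (ε / 2 * L) := by gcongr
    nlinarith

end LBR

/-- The quantities that are asymptotically negligible. -/
theorem eventually_small {n Q : ℕ → ℕ} {R : ℕ → ℝ}
    (hnp : (fun p : ℕ => (n p : ℝ)) =o[atTop] fun p : ℕ => (p : ℝ) / Real.logb 2 p)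
    (hRQ : Tendsto (fun p : ℕ => Real.logb 2 (R p * Q p) / (p : ℝ)) atTop atTop)
    {η : ℝ} (hη : 0 < η) :
    ∀ᶠ p : ℕ in atTop, (p : ℝ) ≤ η * Real.logb 2 (R p * Q p) ∧ (n p : ℝ) ≤ η * p ∧
      (n p : ℝ) * Real.logb 2 p ≤ η * p := by
  filter_upwards [hnp.def hη, hRQ.eventually_ge_atTop (1 / η), eventually_ge_atTop 2]
    with p h1 h2 h3
  have hp : (2 : ℝ) ≤ p := by exact_mod_cast h3
  have hlog : 1 ≤ Real.logb 2 p := by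
    rw [Real.le_logb_iff_rpow_le (by norm_num) (by linarith)]
    simpa using hp
  have h1' : (n p : ℝ) ≤ η * (p / Real.logb 2 p) := by
    rwa [Real.norm_natCast, Real.norm_of_nonneg (by positivity)] at h1
  refine ⟨?_, h1'.trans ?_, ?_⟩
  · rw [div_le_div_iff₀ hη (by linarith)] at h2
    linarith
  · gcongr
    exact div_le_self (by linarith) hlog
  · calc (n p : ℝ) * Real.logb 2 p ≤ η * (p / Real.logb 2 p) * Real.logb 2 p := by gcongr
      _ = η * p := by field_simp

theorem exists_int_of_mem_admissible {p Q : ℕ} (hQ : 0 < Q) {R : ℝ} {β : Fin p → ℝ}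
    (hβ : β ∈ admissible p Q R) :
    ∃ b : Fin p → ℤ, (∀ j, |b j| ≤ (Q * ⌈R⌉₊ : ℕ)) ∧ β = fun j => (b j : ℝ) / Q := by
  choose hR b hb using hβ
  have hQ' : (0 : ℝ) < Q := by exact_mod_cast hQ
  refine ⟨b, fun j => ?_, funext hb⟩
  have h1 : |β j| ≤ R := abs_le.2 (hR j)
  rw [hb j, abs_div, abs_of_pos hQ', div_le_iff₀ hQ'] at h1
  have h2 : |(b j : ℝ)| ≤ ((Q * ⌈R⌉₊ : ℕ) : ℝ) := by
    refine h1.trans ?_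
    push_cast
    rw [mul_comm]
    gcongr
    exact Nat.le_ceil R
  exact_mod_cast h2

theorem tendsto_recoveryProb_law (D : Measure ℝ) [IsProbabilityMeasure D] (c : ℝ) (hc : 0 < c)
    (hD : HasDensityBoundedBy D c) (hmoment : Integrable (fun v : ℝ => v) D)
    (n Q : ℕ → ℕ) (R σ : ℕ → ℝ) (hn : ∀ p, 0 < n p) (hQ : ∀ p, 0 < Q p) (hσ : ∀ p, 0 < σ p)
    (hnp : (fun p : ℕ => (n p : ℝ)) =o[atTop] fun p : ℕ => (p : ℝ) / Real.logb 2 p)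
    (hRQ : Tendsto (fun p : ℕ => Real.logb 2 (R p * Q p) / (p : ℝ)) atTop atTop)
    (ε : ℝ) (hε : 0 < ε) (hR1 : ∀ᶠ p in atTop, 1 ≤ R p)
    (hs : ∀ᶠ p in atTop, σ p < sigmaZero (n p) p (Q p) (R p) ^ (1 + ε))
    (β : (p : ℕ) → Fin p → ℝ) (hβ : ∀ p, β p ∈ admissible p (Q p) (R p)) :
    Tendsto (fun p => recoveryProb (n := n p) D (σ p) (β p)
      (LBR.law ⌊Real.logb 2 (1 / σ p)⌋₊ (Q p) ⌈R p⌉₊ 1)) atTop (𝓝 1) := by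
  set K := ∫ x, |x| ∂D with hKdef
  have hK : 0 ≤ K := integral_nonneg fun x => abs_nonneg x
  set η : ℝ := min (1 / 16) (ε / 122) with hηdef
  have hη : 0 < η := lt_min (by norm_num) (by positivity)
  have hη1 : 16 * η ≤ 1 := by linarith [min_le_left (1 / 16) (ε / 122)]
  have hη2 : 61 * η ≤ ε / 2 := by linarith [min_le_right (1 / 16) (ε / 122)]
  set f : ℕ → ℝ := fun p => (1 + K + 2 * c) / p + (2 : ℝ) ^ (-(p : ℝ)) with hf
  have hf0 : Tendsto f atTop (𝓝 0) := by
    have h1 : Tendsto (fun p : ℕ => (1 + K + 2 * c) / (p : ℝ)) atTop (𝓝 0) :=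
      tendsto_const_div_atTop_nhds_zero_nat _
    have h2 : Tendsto (fun p : ℕ => (2 : ℝ) ^ (-(p : ℝ))) atTop (𝓝 0) := by
      have : (fun p : ℕ => (2 : ℝ) ^ (-(p : ℝ))) = fun p : ℕ => ((1 : ℝ) / 2) ^ p := by
        funext p
        rw [Real.rpow_neg two_pos.le, Real.rpow_natCast, one_div, inv_pow]
      rw [this]
      exact tendsto_pow_atTop_nhds_zero_of_lt_one (by norm_num) (by norm_num)
    have := h1.add h2
    rw [add_zero] at this
    exact this
  set g : ℕ → ℝ := fun p => 16 * (2 / 3) ^ (p - 2) with hg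
  have hg0 : Tendsto g atTop (𝓝 0) := by
    have h1 : Tendsto (fun p : ℕ => ((2 : ℝ) / 3) ^ (p - 2)) atTop (𝓝 0) :=
      (tendsto_pow_atTop_nhds_zero_of_lt_one (by norm_num) (by norm_num)).comp
        (tendsto_sub_atTop_nat 2)
    simpa using h1.const_mul 16
  have hlow : Tendsto (fun p => (1 - ENNReal.ofReal (f p)) * (1 - ENNReal.ofReal (g p))) atTop
      (𝓝 1) := by
    have h : ∀ u : ℕ → ℝ, Tendsto u atTop (𝓝 0) →
        Tendsto (fun p => 1 - ENNReal.ofReal (u p)) atTop (𝓝 1) := fun u hu => by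
      have := ENNReal.Tendsto.sub (tendsto_const_nhds (x := (1 : ℝ≥0∞)))
        (ENNReal.tendsto_ofReal hu) (Or.inl ENNReal.one_ne_top)
      simpa using this
    have := ENNReal.Tendsto.mul (h f hf0) (Or.inl one_ne_zero) (h g hg0) (Or.inl one_ne_zero)
    simpa using this
  have hcp : ∀ᶠ p : ℕ in atTop, 2 * c ≤ (2 : ℝ) ^ (p : ℝ) := by
    filter_upwards [eventually_ge_atTop ⌈2 * c⌉₊] with p hp
    exact (Nat.ceil_le.1 hp).trans (natCast_le_two_rpow p)
  refine tendsto_of_tendsto_of_tendsto_of_le_of_le' hlow tendsto_const_nhds ?_ ?_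
  -- The second use, with `ε / 2`, only supplies `1 ≤ p ≤ ε / 2 * log₂ (R Q)`.
  · filter_upwards [eventually_small hnp hRQ hη, eventually_small hnp hRQ (half_pos hε), hR1, hs,
      hcp, eventually_ge_atTop 6] with p h1 h2 h3 h4 h5 h6
    have hp1 : (1 : ℝ) ≤ p := by exact_mod_cast (by omega : 1 ≤ p)
    obtain ⟨r1, r2, r3⟩ := LBR.recovery_bounds (hn p) (by omega) (hQ p) h3 (hσ p) hc.le hK hε hη
      hη1 hη2 h1.1 (hp1.trans h2.1) h1.2.1 h5 h4
    obtain ⟨b, hb, hβb⟩ := exists_int_of_mem_admissible (hQ p) (hβ p)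
    have hR0 : 0 < ⌈R p⌉₊ := Nat.ceil_pos.2 (by linarith)
    have hnple : n p ≤ p := by
      have : (n p : ℝ) ≤ p := by nlinarith [h1.2.1]
      exact_mod_cast this
    have hG6 : 6 ≤ Q p * ⌈R p⌉₊ := by
      have hQ' : (0 : ℝ) < Q p := by exact_mod_cast hQ p
      have hRQ0 : 0 < R p * Q p := by positivity
      have e1 : (6 : ℝ) ≤ p := by exact_mod_cast h6
      have e2 : (3 : ℝ) ≤ Real.logb 2 (R p * Q p) := by nlinarith [h1.1]
      have e3 : (6 : ℝ) ≤ R p * Q p := by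
        rw [Real.le_logb_iff_rpow_le (by norm_num) hRQ0] at e2
        norm_num at e2
        linarith
      have e4 : R p * Q p ≤ ((Q p * ⌈R p⌉₊ : ℕ) : ℝ) := by
        push_cast
        rw [mul_comm]
        gcongr
        exact Nat.le_ceil _
      have : (6 : ℝ) ≤ ((Q p * ⌈R p⌉₊ : ℕ) : ℝ) := by linarith
      exact_mod_cast this
    have hle := LBR.le_recoveryProb_law (n := n p) hc.le hD hmoment (hn p) hnple (by omega) (hQ p)
      hR0 hG6 (hσ p) hb r2 r1
    rw [hβb]
    refine le_trans ?_ hle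
    gcongr
  · filter_upwards [hR1] with p hp
    exact LBR.recoveryProb_law_le_one _ (hQ p) (Nat.ceil_pos.2 (by linarith)) _ _ _

/-! ### The impossibility of exact recovery -/

theorem hasDensityBoundedBy_gaussianReal {σ : ℝ} (hσ : 0 < σ) :
    HasDensityBoundedBy (gaussianReal 0 (Real.toNNReal (σ ^ 2))) (1 / σ) := by
  have hv : Real.toNNReal (σ ^ 2) ≠ 0 := by
    simpa using hσ.ne'
  refine ⟨gaussianPDF 0 (Real.toNNReal (σ ^ 2)), measurable_gaussianPDF _ _,
    gaussianReal_of_var_ne_zero 0 hv, Eventually.of_forall fun x => ?_⟩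
  refine ENNReal.ofReal_le_ofReal ?_
  rw [gaussianPDFReal, Real.coe_toNNReal _ (sq_nonneg σ)]
  have h1 : Real.exp (-(x - 0) ^ 2 / (2 * σ ^ 2)) ≤ 1 := by
    rw [Real.exp_le_one_iff]
    exact div_nonpos_of_nonpos_of_nonneg (neg_nonpos.2 (sq_nonneg _)) (by positivity)
  have h2 : σ ≤ Real.sqrt (2 * Real.pi * σ ^ 2) := by
    refine Real.le_sqrt_of_sq_le ?_
    nlinarith [Real.pi_gt_three, sq_nonneg σ]
  calc _ ≤ (Real.sqrt (2 * Real.pi * σ ^ 2))⁻¹ * 1 := by gcongr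
    _ ≤ σ⁻¹ := by rw [mul_one]; exact inv_anti₀ hσ h2
    _ = 1 / σ := (one_div σ).symm

theorem HasDensityBoundedBy.le_smul {D : Measure ℝ} {c : ℝ} (hD : HasDensityBoundedBy D c) :
    D ≤ ENNReal.ofReal c • volume :=
  Measure.le_iff.2 fun S hS => by simpa using hD.apply_le hS

/-- The product outer measure is the largest one bounded by the product on boxes, so comparing the
two measures on boxes suffices. -/
theorem Measure.pi_le_pi {n : ℕ} {μ ν : Measure ℝ} [SigmaFinite μ] [SigmaFinite ν] (h : μ ≤ ν) :
    (Measure.pi fun _ : Fin n => μ) ≤ Measure.pi fun _ : Fin n => ν := by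
  refine Measure.le_iff.2 fun S hS => ?_
  have hle : (Measure.pi fun _ : Fin n => μ).toOuterMeasure ≤
      OuterMeasure.pi fun _ : Fin n => ν.toOuterMeasure := by
    rw [OuterMeasure.le_pi]
    intro s _
    change (Measure.pi fun _ : Fin n => μ) (Set.univ.pi s) ≤ _
    rw [Measure.pi_pi]
    exact Finset.prod_le_prod' fun i _ => h (s i)
  conv_rhs => rw [Measure.pi]
  rw [toMeasure_apply _ _ hS]
  exact hle S

theorem HasDensityBoundedBy.pi_le_smul {D : Measure ℝ} [IsProbabilityMeasure D] {c : ℝ}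
    (hD : HasDensityBoundedBy D c) (n : ℕ) :
    (Measure.pi fun _ : Fin n => D) ≤ ENNReal.ofReal c ^ n • volume := by
  have : SigmaFinite (ENNReal.ofReal c • (volume : Measure ℝ)) := by
    have : ENNReal.ofReal c • (volume : Measure ℝ) = c.toNNReal • (volume : Measure ℝ) := rfl
    rw [this]
    infer_instance
  refine (Measure.pi_le_pi hD.le_smul).trans (le_of_eq ?_)
  refine Measure.pi_eq fun s _ => ?_
  rw [Measure.smul_apply, volume_pi_pi]
  simp [Finset.prod_mul_distrib]

/-- The contribution of observations in a box to the total recovery probability is controlled by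
the volume of the box. -/
theorem sum_setLIntegral_le {n p : ℕ} {D : Measure ℝ} [IsProbabilityMeasure D] {σ : ℝ} (hσ : 0 < σ)
    (κ : Kernel ((Fin n → ℝ) × (Fin n → Fin p → ℝ)) (Fin p → ℝ)) [IsMarkovKernel κ]
    (T : Finset (Fin p → ℝ)) {E : Set (Fin n → ℝ)} (hE : MeasurableSet E) :
    ∑ β ∈ T, ∫⁻ d in Prod.fst ⁻¹' E, κ d {β} ∂(dataLaw n D σ β) ≤
      ENNReal.ofReal (1 / σ) ^ n * volume E := by
  set μX : Measure (Fin n → Fin p → ℝ) := Measure.pi fun _ : Fin n => Measure.pi fun _ : Fin p => D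
  set μW : Measure (Fin n → ℝ) :=
    Measure.pi fun _ : Fin n => gaussianReal 0 (Real.toNNReal (σ ^ 2))
  have hκ : ∀ β, Measurable fun d => κ d {β} := fun β =>
    Kernel.measurable_coe κ (measurableSet_singleton β)
  have hFm : ∀ β, Measurable fun d : (Fin n → ℝ) × (Fin n → Fin p → ℝ) =>
      (Prod.fst ⁻¹' E).indicator (fun d => κ d {β}) d := fun β =>
    (hκ β).indicator (measurable_fst hE)
  -- The noise density is at most `σ ^ (-n)`, and translation invariance of Lebesgue measure removes
  -- the shift `X β`. The remaining integral depends on `β` only through the estimator.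
  have hone : ∀ β : Fin p → ℝ, ∫⁻ d in Prod.fst ⁻¹' E, κ d {β} ∂(dataLaw n D σ β) ≤
      ∫⁻ X, ENNReal.ofReal (1 / σ) ^ n *
        ∫⁻ Y, (Prod.fst ⁻¹' E).indicator (fun d => κ d {β}) (Y, X) ∂volume ∂μX := by
    intro β
    have hobs := LBR.measurable_observe (n := n) β
    rw [← lintegral_indicator (measurable_fst hE), dataLaw, lintegral_map (hFm β) hobs]
    refine (lintegral_prod _ ((hFm β).comp hobs).aemeasurable).trans_le ?_
    refine lintegral_mono fun X => ?_
    calc ∫⁻ W, (Prod.fst ⁻¹' E).indicator (fun d => κ d {β})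
          (fun i => (∑ j, X i j * β j) + W i, X) ∂μW
        ≤ ∫⁻ W, (Prod.fst ⁻¹' E).indicator (fun d => κ d {β})
          (fun i => (∑ j, X i j * β j) + W i, X) ∂(ENNReal.ofReal (1 / σ) ^ n • volume) :=
          lintegral_mono' ((hasDensityBoundedBy_gaussianReal hσ).pi_le_smul n) le_rfl
      _ = ENNReal.ofReal (1 / σ) ^ n * ∫⁻ W, (Prod.fst ⁻¹' E).indicator (fun d => κ d {β})
          ((fun i => ∑ j, X i j * β j) + W, X) ∂volume := by
          rw [lintegral_smul_measure]
          rfl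
      _ = _ := by
          rw [lintegral_add_left_eq_self (fun Y : Fin n → ℝ =>
            (Prod.fst ⁻¹' E).indicator (fun d => κ d {β}) (Y, X))]
  have hFm' : ∀ β X, Measurable fun Y : Fin n → ℝ =>
      (Prod.fst ⁻¹' E).indicator (fun d => κ d {β}) (Y, X) := fun β X =>
    (hFm β).comp (measurable_id.prodMk measurable_const)
  have hFint : ∀ β, Measurable fun X : Fin n → Fin p → ℝ =>
      ∫⁻ Y, (Prod.fst ⁻¹' E).indicator (fun d => κ d {β}) (Y, X) ∂volume := fun β =>
    (hFm β).lintegral_prod_left'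
  calc _ ≤ ∑ β ∈ T, ∫⁻ X, ENNReal.ofReal (1 / σ) ^ n *
        ∫⁻ Y, (Prod.fst ⁻¹' E).indicator (fun d => κ d {β}) (Y, X) ∂volume ∂μX :=
        Finset.sum_le_sum fun β _ => hone β
    _ = ∫⁻ X, ∑ β ∈ T, ENNReal.ofReal (1 / σ) ^ n *
        ∫⁻ Y, (Prod.fst ⁻¹' E).indicator (fun d => κ d {β}) (Y, X) ∂volume ∂μX :=
        (lintegral_finsetSum _ fun β _ => (hFint β).const_mul _).symm
    _ ≤ ∫⁻ _, ENNReal.ofReal (1 / σ) ^ n * volume E ∂μX := by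
        refine lintegral_mono fun X => ?_
        rw [← Finset.mul_sum, ← lintegral_finsetSum _ fun β _ => hFm' β X]
        gcongr
        rw [← lintegral_indicator_one hE]
        refine lintegral_mono fun Y => ?_
        by_cases hY : Y ∈ E
        · rw [Set.indicator_of_mem hY]
          have : ∀ β, (Prod.fst ⁻¹' E).indicator (fun d => κ d {β}) (Y, X) = κ (Y, X) {β} :=
            fun β => Set.indicator_of_mem (by exact hY) _
          simp only [this]
          -- Distinct candidates share the total mass `1` of the estimator's output law.
          rw [sum_measure_singleton]
          exact prob_le_one
        · have : ∀ β, (Prod.fst ⁻¹' E).indicator (fun d => κ d {β}) (Y, X) = 0 :=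
            fun β => Set.indicator_of_notMem (by exact hY) _
          simp [this]
    _ = _ := by simp

/-- The observations lie in a box of explicit size with probability at least `1 / 2`. -/
theorem dataLaw_box_compl_le {n p : ℕ} (hn : 0 < n) {D : Measure ℝ} [IsProbabilityMeasure D]
    (hmoment : Integrable (fun v : ℝ => v) D) {R σ : ℝ} (hR : 0 < R) (hσ : 0 < σ) {β : Fin p → ℝ}
    (hβ : ∀ j, |β j| ≤ R) :
    dataLaw n D σ β (Prod.fst ⁻¹' Set.univ.pi fun _ =>
      Metric.closedBall 0 (4 * n * R * (p * (∫ x, |x| ∂D) + 1) + 2 * n * σ))ᶜ ≤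
      ENNReal.ofReal (1 / 2) := by
  have hK : 0 ≤ ∫ x, |x| ∂D := integral_nonneg fun x => abs_nonneg x
  obtain ⟨K, hKdef⟩ : ∃ K, K = ∫ x, |x| ∂D := ⟨_, rfl⟩
  rw [← hKdef] at hK ⊢
  have hn' : (1 : ℝ) ≤ n := by exact_mod_cast hn
  have hobs := LBR.measurable_observe (n := n) β
  rw [dataLaw, Measure.map_apply hobs]
  swap
  · exact measurable_fst (MeasurableSet.univ_pi fun _ =>
      Metric.isClosed_closedBall.measurableSet).compl
  set μX : Measure (Fin n → Fin p → ℝ) := Measure.pi fun _ : Fin n => Measure.pi fun _ : Fin p => D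
  set μW : Measure (Fin n → ℝ) :=
    Measure.pi fun _ : Fin n => gaussianReal 0 (Real.toNNReal (σ ^ 2))
  -- Chebyshev for the noise and Markov for the rows, with thresholds chosen so that each union over
  -- `n` rows costs at most `1 / 4`.
  set B1 : Set (Fin n → ℝ) := {W | ∃ i, W i ∈ {w : ℝ | 2 * n * σ ≤ |w|}} with hB1
  set B2 : Set (Fin n → Fin p → ℝ) :=
    {X | ∃ i, X i ∈ {x : Fin p → ℝ | 4 * n * (p * K + 1) ≤ ∑ j, |x j|}} with hB2
  have hsub : (fun XW : (Fin n → Fin p → ℝ) × (Fin n → ℝ) =>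
      ((fun i => (∑ j, XW.1 i j * β j) + XW.2 i, XW.1) :
        (Fin n → ℝ) × (Fin n → Fin p → ℝ))) ⁻¹' (Prod.fst ⁻¹' (Set.univ.pi fun _ =>
      Metric.closedBall 0 (4 * n * R * (p * K + 1) + 2 * n * σ))ᶜ) ⊆
      Set.univ ×ˢ B1 ∪ B2 ×ˢ Set.univ := by
    rintro ⟨X, W⟩ h
    by_contra hnot
    simp only [Set.mem_union, Set.mem_prod, Set.mem_univ, true_and, and_true, not_or, hB1, hB2,
      Set.mem_ofPred_eq, not_exists, not_le] at hnot
    refine h fun i _ => ?_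
    rw [Metric.mem_closedBall, Real.dist_eq, sub_zero]
    change |(∑ j, X i j * β j) + W i| ≤ _
    refine (abs_add_le _ _).trans (add_le_add ?_ (hnot.1 i).le)
    calc |∑ j, X i j * β j| ≤ ∑ j, |X i j| * R := by
          refine (Finset.abs_sum_le_sum_abs _ _).trans (Finset.sum_le_sum fun j _ => ?_)
          rw [abs_mul]
          gcongr
          exact hβ j
      _ = (∑ j, |X i j|) * R := by rw [Finset.sum_mul]
      _ ≤ (4 * n * (p * K + 1)) * R := by gcongr; exact (hnot.2 i).le
      _ = _ := by ring
  have hp1 : μW B1 ≤ ENNReal.ofReal (1 / 4) := by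
    refine (pi_exists_le _ (measurableSet_le measurable_const measurable_abs)).trans ?_
    refine (mul_le_mul_right (gaussianReal_abs_ge_le σ (by positivity)) _).trans ?_
    rw [← ENNReal.ofReal_natCast, ← ENNReal.ofReal_mul (by positivity)]
    refine ENNReal.ofReal_le_ofReal ?_
    have : (n : ℝ) * (σ ^ 2 / (2 * n * σ) ^ 2) = 1 / (4 * n) := by field_simp; ring
    rw [this]
    exact one_div_le_one_div_of_le (by norm_num) (by linarith)
  have hp2 : μX B2 ≤ ENNReal.ofReal (1 / 4) := by
    refine (pi_exists_le _ (measurableSet_le measurable_const ?_)).trans ?_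
    · fun_prop
    refine (mul_le_mul_right (pi_sum_abs_ge_le D hmoment p (by positivity)) _).trans ?_
    rw [← hKdef, ← ENNReal.ofReal_natCast, ← ENNReal.ofReal_mul (by positivity)]
    refine ENNReal.ofReal_le_ofReal ?_
    rw [← mul_div_assoc, div_le_div_iff₀ (by positivity) (by norm_num)]
    nlinarith
  refine (measure_mono hsub).trans ((measure_union_le _ _).trans ?_)
  rw [Measure.prod_prod, Measure.prod_prod, measure_univ, measure_univ, one_mul, mul_one]
  refine (add_le_add hp1 hp2).trans (le_of_eq ?_)
  rw [← ENNReal.ofReal_add (by norm_num) (by norm_num)]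
  norm_num

/-- Some coefficient vector is recovered with probability at most `1 / 2`, up to the ratio of the
number of distinguishable observations to the number of coefficient vectors. -/
theorem exists_recoveryProb_le {n p Q : ℕ} (hn : 0 < n) (hQ : 0 < Q) {D : Measure ℝ}
    [IsProbabilityMeasure D] (hmoment : Integrable (fun v : ℝ => v) D) {R σ : ℝ} (hR : 0 < R)
    (hσ : 0 < σ) (κ : Kernel ((Fin n → ℝ) × (Fin n → Fin p → ℝ)) (Fin p → ℝ)) [IsMarkovKernel κ] :
    ∃ β ∈ admissible p Q R, recoveryProb D σ β κ ≤ ENNReal.ofReal (1 / 2 +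
      (1 / σ * (2 * (4 * n * R * (p * (∫ x, |x| ∂D) + 1) + 2 * n * σ))) ^ n / (R * Q) ^ p) := by
  classical
  have hK : 0 ≤ ∫ x, |x| ∂D := integral_nonneg fun x => abs_nonneg x
  have hQ' : (0 : ℝ) < Q := by exact_mod_cast hQ
  set B := 4 * n * R * (p * (∫ x, |x| ∂D) + 1) + 2 * n * σ with hB
  have hB0 : 0 ≤ B := by positivity
  set k := ⌊R * Q⌋₊ with hk
  set V : Finset (Fin p → ℤ) := Fintype.piFinset fun _ => Finset.Icc (-(k : ℤ)) k with hV
  let φ : (Fin p → ℤ) → Fin p → ℝ := fun b j => (b j : ℝ) / Q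
  have hφ : Function.Injective φ := fun a b hab => by
    funext j
    have := congrFun hab j
    simp only [φ] at this
    rw [div_left_inj' hQ'.ne'] at this
    exact_mod_cast this
  set T := V.image φ with hT
  have hTR : ∀ β ∈ T, β ∈ admissible p Q R := by
    intro β hβ j
    obtain ⟨b, hb, rfl⟩ := Finset.mem_image.1 hβ
    refine ⟨?_, b j, rfl⟩
    have h1 := Finset.mem_Icc.1 (Fintype.mem_piFinset.1 hb j)
    have h2 : |(b j : ℝ)| ≤ k := by exact_mod_cast abs_le.2 h1
    have h3 : (k : ℝ) ≤ R * Q := Nat.floor_le (by positivity)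
    rw [Set.mem_Icc, ← abs_le, abs_div, abs_of_pos hQ', div_le_iff₀ hQ']
    linarith
  -- With `k = ⌊R Q⌋` each coordinate has `2 k + 1 > R Q` admissible values.
  have hTcard : (R * Q) ^ p ≤ (T.card : ℝ) := by
    rw [hT, Finset.card_image_of_injective _ hφ, hV, Fintype.card_piFinset_const, Int.card_Icc]
    push_cast
    gcongr
    have h1 : R * Q < k + 1 := Nat.lt_floor_add_one _
    have h2 : ((k + 1 - -(k : ℤ)).toNat : ℝ) = 2 * k + 1 := by
      rw [show (k + 1 - -(k : ℤ)).toNat = 2 * k + 1 by omega]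
      push_cast
      ring
    rw [h2]
    have : (0 : ℝ) ≤ k := Nat.cast_nonneg k
    linarith
  have hTpos : (0 : ℝ) < T.card := lt_of_lt_of_le (by positivity) hTcard
  set E : Set (Fin n → ℝ) := Set.univ.pi fun _ => Metric.closedBall 0 B with hE
  have hEm : MeasurableSet E :=
    MeasurableSet.univ_pi fun _ => Metric.isClosed_closedBall.measurableSet
  have hsum : ∑ β ∈ T, recoveryProb D σ β κ ≤
      ∑ _β ∈ T, ENNReal.ofReal (1 / 2 + (1 / σ * (2 * B)) ^ n / (R * Q) ^ p) := by
    have hsplit : ∀ β ∈ T, recoveryProb D σ β κ ≤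
        (∫⁻ d in Prod.fst ⁻¹' E, κ d {β} ∂(dataLaw n D σ β)) + ENNReal.ofReal (1 / 2) := by
      intro β hβ
      rw [recoveryProb, ← lintegral_add_compl _ (measurable_fst hEm)]
      gcongr
      calc _ ≤ ∫⁻ _ in (Prod.fst ⁻¹' E)ᶜ, 1 ∂(dataLaw n D σ β) :=
            lintegral_mono fun d => prob_le_one
        _ = dataLaw n D σ β (Prod.fst ⁻¹' Eᶜ) := by rw [setLIntegral_one]; rfl
        _ ≤ _ := dataLaw_box_compl_le hn hmoment hR hσ fun j => abs_le.2 (hTR β hβ j).1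
    have hvol : ENNReal.ofReal (1 / σ) ^ n * volume E =
        ENNReal.ofReal ((1 / σ * (2 * B)) ^ n) := by
      rw [hE, volume_pi_pi]
      simp only [Real.volume_closedBall, Finset.prod_const, Finset.card_univ, Fintype.card_fin]
      rw [← mul_pow, ← ENNReal.ofReal_mul (by positivity), ENNReal.ofReal_pow (by positivity)]
    calc _ ≤ ∑ β ∈ T, ((∫⁻ d in Prod.fst ⁻¹' E, κ d {β} ∂(dataLaw n D σ β)) +
          ENNReal.ofReal (1 / 2)) := Finset.sum_le_sum hsplit
      _ ≤ ENNReal.ofReal ((1 / σ * (2 * B)) ^ n) + T.card * ENNReal.ofReal (1 / 2) := by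
          rw [Finset.sum_add_distrib, Finset.sum_const, nsmul_eq_mul, ← hvol]
          gcongr
          exact sum_setLIntegral_le hσ κ T hEm
      _ ≤ _ := by
          rw [Finset.sum_const, nsmul_eq_mul, ← ENNReal.ofReal_natCast,
            ← ENNReal.ofReal_mul hTpos.le, ← ENNReal.ofReal_mul hTpos.le,
            ← ENNReal.ofReal_add (by positivity) (by positivity)]
          refine ENNReal.ofReal_le_ofReal ?_
          have h : (1 / σ * (2 * B)) ^ n ≤ T.card * ((1 / σ * (2 * B)) ^ n / (R * Q) ^ p) := by
            rw [← mul_div_assoc, le_div_iff₀ (by positivity), mul_comm]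
            exact mul_le_mul_of_nonneg_right hTcard (by positivity)
          linarith
  have hTne : T.Nonempty := Finset.card_pos.1 (by exact_mod_cast hTpos)
  -- The least recovery probability is at most the average over `T`.
  obtain ⟨β, hβ, hmin⟩ := T.exists_min_image (fun β => recoveryProb D σ β κ) hTne
  refine ⟨β, hTR β hβ, ?_⟩
  have hle := (Finset.card_nsmul_le_sum T _ _ hmin).trans hsum
  rw [Finset.sum_const, nsmul_eq_mul, nsmul_eq_mul] at hle
  exact (ENNReal.mul_le_mul_iff_right (by simpa using hTne.ne_empty)
    (ENNReal.natCast_ne_top _)).1 hle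

/-- The ratio in `exists_recoveryProb_le` is small above the threshold. -/
theorem impossibility_bound {n p Q : ℕ} {R σ K ε η C : ℝ} (hn : 0 < n) (hp : 1 ≤ p) (hQ : 0 < Q)
    (hR : 0 < R) (hσ : 0 < σ) (hK : 0 ≤ K) (hε1 : ε ≤ 1) (hη : 0 < η)
    (hη1 : η ≤ ε / 4) (hC0 : 0 ≤ C) (hC : 16 * (K + 1) ≤ (2 : ℝ) ^ C)
    (hCL : C + 2 ≤ Real.logb 2 (R * Q)) (hL : 4 ≤ ε * Real.logb 2 (R * Q))
    (hnη : n ≤ η * p) (hnlog : n * Real.logb 2 p ≤ η * p)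
    (hs : sigmaZero n p Q R ^ (1 - ε) < σ) :
    (1 / σ * (2 * (4 * n * R * (p * K + 1) + 2 * n * σ))) ^ n / (R * Q) ^ p ≤ 1 / 4 := by
  have hp' : (1 : ℝ) ≤ p := by exact_mod_cast hp
  have hn' : (1 : ℝ) ≤ n := by exact_mod_cast hn
  have hQ' : (1 : ℝ) ≤ Q := by exact_mod_cast hQ
  have hRQ : 0 < R * Q := by positivity
  have hnp : (n : ℝ) ≤ p := by nlinarith
  rw [sigmaZero_rpow] at hs
  have hRQL : R * Q = (2 : ℝ) ^ Real.logb 2 (R * Q) :=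
    (Real.rpow_logb two_pos (by norm_num) hRQ).symm
  generalize Real.logb 2 (R * Q) = L at *
  have hL0 : 0 ≤ L := by linarith
  have hpe : (p : ℝ) = (2 : ℝ) ^ (Real.logb 2 p) :=
    (Real.rpow_logb two_pos (by norm_num) (by linarith)).symm
  have hRL : R ≤ (2 : ℝ) ^ L := by
    rw [← hRQL]
    exact le_mul_of_one_le_right hR.le hQ'
  obtain ⟨y, hy⟩ : ∃ y, y = p * L / n * (1 - ε) := ⟨_, rfl⟩
  rw [← hy] at hs
  have hy0 : 0 ≤ y := hy ▸ mul_nonneg (by positivity) (by linarith)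
  have hσinv : σ⁻¹ ≤ (2 : ℝ) ^ y := by
    have := inv_anti₀ (Real.rpow_pos_of_pos two_pos _) hs.le
    rwa [← Real.rpow_neg two_pos.le, neg_neg] at this
  have hRσ : R * σ⁻¹ ≤ (2 : ℝ) ^ (L + y) := mul_le_two_rpow (by positivity) hRL hσinv
  have h1 : (1 : ℝ) ≤ (2 : ℝ) ^ (L + y) := Real.one_le_rpow (by norm_num) (by linarith)
  have hbase : 1 / σ * (2 * (4 * n * R * (p * K + 1) + 2 * n * σ)) ≤
      (2 : ℝ) ^ (C + 2 * Real.logb 2 p + (L + y)) := by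
    have e1 : 1 / σ * (2 * (4 * n * R * (p * K + 1) + 2 * n * σ)) =
        n * (8 * (p * K + 1) * (R * σ⁻¹) + 4) := by
      field_simp
      ring
    have e2 : (n : ℝ) * (8 * (p * K + 1) * (R * σ⁻¹) + 4) ≤
        p * (16 * (p * (K + 1)) * (2 : ℝ) ^ (L + y)) := by
      have e3 : (p : ℝ) * K + 1 ≤ p * (K + 1) := by nlinarith
      have e4 : (1 : ℝ) ≤ p * (K + 1) := one_le_mul_of_one_le_of_one_le hp' (by linarith)
      have e5 : 1 ≤ p * (K + 1) * (2 : ℝ) ^ (L + y) := one_le_mul_of_one_le_of_one_le e4 h1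
      have e6 : (p * K + 1) * (R * σ⁻¹) ≤ p * (K + 1) * (2 : ℝ) ^ (L + y) := by gcongr
      refine mul_le_mul hnp ?_ (by positivity) (by positivity)
      nlinarith
    have e7 : (p : ℝ) * (16 * (p * (K + 1)) * (2 : ℝ) ^ (L + y)) =
        16 * (K + 1) * ((p : ℝ) * p) * (2 : ℝ) ^ (L + y) := by ring
    rw [e1]
    refine e2.trans ?_
    rw [e7]
    have e8 := mul_le_two_rpow (by positivity) (mul_le_two_rpow (by positivity) hC
      (mul_le_two_rpow (by positivity) hpe.le hpe.le)) (le_refl ((2 : ℝ) ^ (L + y)))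
    exact le_two_rpow_mono e8 (by linarith)
  have hpow := pow_le_two_rpow (by positivity) hbase n
  rw [div_le_iff₀ (by positivity)]
  refine hpow.trans ?_
  rw [hRQL, ← Real.rpow_natCast, ← Real.rpow_mul two_pos.le,
    show (1 : ℝ) / 4 = (2 : ℝ) ^ (-2 : ℝ) by norm_num [Real.rpow_neg], ← Real.rpow_add two_pos]
  refine Real.rpow_le_rpow_of_exponent_le (by norm_num) ?_
  -- After cancelling `p L` a gain `ε p L` remains. The terms `n C + 2 n log p` and `n L` each take
  -- at most a quarter, and the remaining half is at least `2`, giving the factor `1 / 4 = 2 ^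
  -- (-2)`.
  have e1 : (n : ℝ) * y = p * L * (1 - ε) := by
    rw [hy]
    field_simp
  have e2 : (n : ℝ) * (C + 2 * Real.logb 2 p + (L + y)) =
      n * C + 2 * (n * Real.logb 2 p) + n * L + p * L * (1 - ε) := by rw [← e1]; ring
  rw [e2]
  have e3 : (n : ℝ) * C ≤ η * p * C := mul_le_mul_of_nonneg_right hnη hC0
  have e4 : (n : ℝ) * L ≤ η * p * L := mul_le_mul_of_nonneg_right hnη hL0
  have e5 : η * p * (C + 2) ≤ η * p * L := mul_le_mul_of_nonneg_left hCL (by positivity)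
  have e6 : η * p * L ≤ ε / 4 * p * L :=
    mul_le_mul_of_nonneg_right (mul_le_mul_of_nonneg_right hη1 (by positivity)) hL0
  have e7 : 1 * 4 ≤ p * (ε * L) := mul_le_mul hp' hL (by norm_num) (by positivity)
  linarith

theorem limsup_recoveryProb_lt_one (D : Measure ℝ) [IsProbabilityMeasure D]
    (hmoment : Integrable (fun v : ℝ => v) D)
    (n Q : ℕ → ℕ) (R σ : ℕ → ℝ)
    (hn : ∀ p, 0 < n p) (hQ : ∀ p, 0 < Q p) (hR : ∀ p, 0 < R p) (hσ : ∀ p, 0 < σ p)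
    (hnp : (fun p : ℕ => (n p : ℝ)) =o[atTop] fun p : ℕ => (p : ℝ) / Real.logb 2 p)
    (hRQ : Tendsto (fun p : ℕ => Real.logb 2 (R p * Q p) / (p : ℝ)) atTop atTop)
    (ε : ℝ) (hε : 0 < ε)
    (hs : ∀ᶠ p in atTop, sigmaZero (n p) p (Q p) (R p) ^ (1 - ε) < σ p)
    (κ : (p : ℕ) → Kernel ((Fin (n p) → ℝ) × (Fin (n p) → Fin p → ℝ)) (Fin p → ℝ))
    (hκ : ∀ p, IsMarkovKernel (κ p)) :
    ∃ β : (p : ℕ) → Fin p → ℝ, (∀ p, β p ∈ admissible p (Q p) (R p)) ∧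
      limsup (fun p => recoveryProb D (σ p) (β p) (κ p)) atTop < 1 := by
  choose β hβ hle using fun p => exists_recoveryProb_le (hn p) (hQ p) hmoment (hR p) (hσ p) (κ p)
  refine ⟨β, hβ, ?_⟩
  set K := ∫ x, |x| ∂D with hKdef
  have hK : 0 ≤ K := integral_nonneg fun x => abs_nonneg x
  -- Replacing `ε` by `min ε 1` keeps `1 - ε` nonnegative and only lowers the threshold, because `σ₀
  -- ≤ 1` for large `p`.
  set ε' := min ε 1 with hε'def
  have hε' : 0 < ε' := lt_min hε one_pos
  set C := Real.logb 2 (16 * (K + 1)) with hCdef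
  have hC : 16 * (K + 1) ≤ (2 : ℝ) ^ C :=
    (Real.rpow_logb two_pos (by norm_num) (by positivity)).ge
  have hC0 : 0 ≤ C := Real.logb_nonneg (by norm_num) (by linarith)
  have hev : ∀ᶠ p in atTop, recoveryProb D (σ p) (β p) (κ p) ≤ ENNReal.ofReal (3 / 4) := by
    filter_upwards [eventually_small hnp hRQ (η := ε' / 4) (by positivity), hs,
      -- This choice of `η` yields `C + 2 ≤ log₂ (R Q)`, so that the constants are dominated.
      eventually_small hnp hRQ (η := 1 / (C + 2)) (by positivity), eventually_ge_atTop 1]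
      with p h1 h2 h3 h4
    have hp : (1 : ℝ) ≤ p := by exact_mod_cast h4
    have hL4 : 4 ≤ ε' * Real.logb 2 (R p * Q p) := by linarith [h1.1]
    have hL0 : 0 ≤ Real.logb 2 (R p * Q p) := by
      by_contra h
      nlinarith [not_le.1 h]
    have hLC : C + 2 ≤ Real.logb 2 (R p * Q p) := by
      have := hp.trans h3.1
      rwa [one_div, inv_mul_eq_div, one_le_div (by positivity)] at this
    have h2' : sigmaZero (n p) p (Q p) (R p) ^ (1 - ε') < σ p := by
      refine lt_of_le_of_lt ?_ h2
      rw [sigmaZero_rpow, sigmaZero_rpow]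
      refine Real.rpow_le_rpow_of_exponent_le (by norm_num) ?_
      have : 0 ≤ p * Real.logb 2 (R p * Q p) / n p := by positivity
      have : ε' ≤ ε := min_le_left _ _
      nlinarith
    have hb := impossibility_bound (hn p) h4 (hQ p) (hR p) (hσ p) hK (min_le_right _ _)
      (show 0 < ε' / 4 by positivity) le_rfl hC0 hC hLC hL4 h1.2.1 h1.2.2 h2'
    refine (hle p).trans (ENNReal.ofReal_le_ofReal ?_)
    linarith
  calc _ ≤ ENNReal.ofReal (3 / 4) := limsup_le_of_le (by isBoundedDefault) hev
    _ < 1 := by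
        rw [← ENNReal.ofReal_one]
        exact (ENNReal.ofReal_lt_ofReal_iff one_pos).2 (by norm_num)

theorem mainTheorem6
    (D : Measure ℝ) [IsProbabilityMeasure D] (c : ℝ) (hc : 0 < c)
    (hD : HasDensityBoundedBy D c) (hmoment : Integrable (fun v : ℝ => v) D)
    (n Q : ℕ → ℕ) (R σ : ℕ → ℝ)
    (hn : ∀ p, 0 < n p) (hQ : ∀ p, 0 < Q p) (hR : ∀ p, 0 < R p) (hσ : ∀ p, 0 < σ p)
    (hnp : (fun p : ℕ => (n p : ℝ)) =o[atTop] fun p : ℕ => (p : ℝ) / Real.logb 2 p)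
    (hRQ : Tendsto (fun p : ℕ => Real.logb 2 (R p * Q p) / (p : ℝ)) atTop atTop)
    (ε : ℝ) (hε : 0 < ε) :
    ((∀ᶠ p in atTop, sigmaZero (n p) p (Q p) (R p) ^ (1 - ε) < σ p) →
      ∀ κ : (p : ℕ) → Kernel ((Fin (n p) → ℝ) × (Fin (n p) → Fin p → ℝ)) (Fin p → ℝ),
        (∀ p, IsMarkovKernel (κ p)) →
        ∃ β : (p : ℕ) → Fin p → ℝ, (∀ p, β p ∈ admissible p (Q p) (R p)) ∧
          limsup (fun p => recoveryProb D (σ p) (β p) (κ p)) atTop < 1) ∧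
    ((∀ᶠ p in atTop, 1 ≤ R p) →
      (∀ᶠ p in atTop, σ p < sigmaZero (n p) p (Q p) (R p) ^ (1 + ε)) →
      ∀ β : (p : ℕ) → Fin p → ℝ, (∀ p, β p ∈ admissible p (Q p) (R p)) →
        Tendsto
          (fun p => recoveryProb (n := n p) D (σ p) (β p)
            (LBR.law ⌊Real.logb 2 (1 / σ p)⌋₊ (Q p) ⌈R p⌉₊ 1))
          atTop (𝓝 1)) :=
  ⟨fun hs κ hκ => limsup_recoveryProb_lt_one D hmoment n Q R σ hn hQ hR hσ hnp hRQ ε hε hs κ hκ,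
    fun hR1 hs β hβ => tendsto_recoveryProb_law D c hc hD hmoment n Q R σ hn hQ hσ hnp hRQ ε hε
      hR1 hs β hβ⟩
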